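/- Let $f\in C^3(\mathbb R;\mathbb R)$, put $F(\rho)=\int_\rho^1 f(r)\,dr$, and assume that there is $\lambda>0$ with $\lambda(1-\rho)^2\le F(\rho)$ for all $\rho\ge 0$ (this forces $f(1)=0$ and $f'(1)<0$). Let $$\mathcal X^1=\{u\in H^1_{\mathrm{loc}}(\mathbb R;\mathbb C): u'\in L^2(\mathbb R),\ F(|u|^2)\in L^1(\mathbb R)\},\qquad \mathcal{NX}^1=\{u\in\mathcal X^1:\inf_{\mathbb R}|u|>0\},$$ where functions in $H^1_{\mathrm{loc}}$ are identified with their continuous representatives, and define $$E(u)=\frac12\int_{\mathbb R}|u'|^2+\frac12\int_{\mathbb R}F(|u|^2)\quad(u\in\mathcal X^1),\qquad p(u)=\frac12\int_{\mathbb R}\mathrm{Re}\big(u\,\overline{iu'}\big)\Big(1-\frac1{|u|^2}\Big)\quad(u\in\mathcal{NX}^1),$$ $$E_{\min}(q)=\inf\{E(v): v\in\mathcal{NX}^1,\ p(v)=q\}\quad(q\in\mathbb R),$$ $$q_*=\sup\big\{q>0:\ \text{every } v\in\mathcal X^1 \text{ with } E(v)\le E_{\min}(q) \text{ satisfies } \inf_{\mathbb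 R}|v|>0\big\}.$$ A black soliton (kink) is a nonconstant $v_0\in C^2(\mathbb R;\mathbb C)$ with $v_0''+v_0f(|v_0|^2)=0$ on $\mathbb R$ and $|v_0(x)|\to1$ as $|x|\to\infty$. Then the set defining $q_*$ is nonempty and bounded above, so that $q_*$ is a positive real number; a black soliton exists; every black soliton $v_0$ belongs to $\mathcal X^1$; and for every black soliton $v_0$ and every real $q\ge q_*$, $$E_{\min}(q)=E(v_0).$$ In particular $E_{\min}$ is constant on $[q_*,\infty)$. -/

import Mathlib

open MeasureTheory Filter Topology Set
open scoped ContDiff ComplexConjugate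

namespace NLS

/-- `g` is the weak (distributional) derivative of `u` on the real line. -/
structure IsWeakDeriv (u g : ℝ → ℂ) : Prop where
  locallyIntegrable : LocallyIntegrable u volume
  locallyIntegrable_deriv : LocallyIntegrable g volume
  integral_eq : ∀ φ : ℝ → ℝ, ContDiff ℝ ∞ φ → HasCompactSupport φ →
    ∫ x, deriv φ x • u x = - ∫ x, φ x • g x

/-- The weak derivative is unique up to null sets. -/
theorem IsWeakDeriv.ae_eq {u g h : ℝ → ℂ} (hg : IsWeakDeriv u g) (hh : IsWeakDeriv u h) :
    g =ᵐ[volume] h := by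
  refine ae_eq_of_integral_contDiff_smul_eq hg.locallyIntegrable_deriv
    hh.locallyIntegrable_deriv fun φ hφ hc => ?_
  have h1 := hg.integral_eq φ hφ hc
  rw [hh.integral_eq φ hφ hc] at h1
  exact (neg_injective h1).symm

open Classical in
/-- A chosen weak derivative of `u` (well defined almost everywhere); zero if there is none. -/
noncomputable def weakDeriv (u : ℝ → ℂ) : ℝ → ℂ :=
  if h : ∃ g, IsWeakDeriv u g then Classical.choose h else 0

theorem IsWeakDeriv.weakDeriv {u g : ℝ → ℂ} (hg : IsWeakDeriv u g) :
    IsWeakDeriv u (weakDeriv u) := by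
  have h : ∃ g, IsWeakDeriv u g := ⟨g, hg⟩
  unfold NLS.weakDeriv
  rw [dif_pos h]
  exact Classical.choose_spec h

theorem IsWeakDeriv.weakDeriv_ae_eq {u g : ℝ → ℂ} (hg : IsWeakDeriv u g) :
    NLS.weakDeriv u =ᵐ[volume] g :=
  hg.weakDeriv.ae_eq hg

/-- A continuously differentiable function has its classical derivative as weak derivative. -/
theorem isWeakDeriv_deriv {u : ℝ → ℂ} (hu : ContDiff ℝ 1 u) : IsWeakDeriv u (deriv u) := by
  have hd : Continuous (deriv u) := hu.continuous_deriv le_rfl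
  refine ⟨hu.continuous.locallyIntegrable, hd.locallyIntegrable, fun φ hφ hc => ?_⟩
  have hφd : Continuous (deriv φ) := hφ.continuous_deriv (by simp)
  have h := integral_bilinear_hasDerivAt_right_eq_neg_left_of_integrable
    (L := (ContinuousLinearMap.lsmul ℝ ℝ : ℝ →L[ℝ] ℂ →L[ℝ] ℂ))
    (u := φ) (v := u) (u' := deriv φ) (v' := deriv u)
    (fun x _ => (hφ.differentiable (by simp) x).hasDerivAt)
    (fun x _ => (hu.differentiable (by simp) x).hasDerivAt)
    ((hφ.continuous.smul hd).integrable_of_hasCompactSupport hc.smul_right)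
    ((hφd.smul hu.continuous).integrable_of_hasCompactSupport hc.deriv.smul_right)
    ((hφ.continuous.smul hu.continuous).integrable_of_hasCompactSupport hc.smul_right)
  simp only [ContinuousLinearMap.lsmul_apply] at h
  rw [h, neg_neg]

/-- `H¹_loc(ℝ; ℂ)`; in one space dimension every class has a unique continuous representative,
and the elements are these representatives. -/
def H1Loc : Set (ℝ → ℂ) :=
  {u | Continuous u ∧ ∃ g, IsWeakDeriv u g ∧ ∀ a b : ℝ, MemLp g 2 (volume.restrict (Icc a b))}

/-- The potential `F(ρ) = ∫_ρ^1 f(r) dr`. -/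
noncomputable def potential (f : ℝ → ℝ) (ρ : ℝ) : ℝ := ∫ r in ρ..1, f r

/-- The energy space `𝒳¹(ℝ)`. -/
def energySpace (f : ℝ → ℝ) : Set (ℝ → ℂ) :=
  {u | u ∈ H1Loc ∧ MemLp (weakDeriv u) 2 volume ∧
    Integrable (fun x => potential f (‖u x‖ ^ 2)) volume}

/-- The nonvanishing energy space `𝒩𝒳¹(ℝ)`. -/
def nonvanishingEnergySpace (f : ℝ → ℝ) : Set (ℝ → ℂ) :=
  {u | u ∈ energySpace f ∧ 0 < ⨅ x, ‖u x‖}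

/-- The Ginzburg-Landau energy `E(u)`. -/
noncomputable def energy (f : ℝ → ℝ) (u : ℝ → ℂ) : ℝ :=
  1 / 2 * (∫ x, ‖weakDeriv u x‖ ^ 2) + 1 / 2 * ∫ x, potential f (‖u x‖ ^ 2)

/-- The renormalized momentum `p(u) = 1/2 ∫ ⟨u, i u'⟩ (1 - 1/|u|²)`,
with `⟨z, w⟩ = Re (z * conj w)`. -/
noncomputable def momentum (u : ℝ → ℂ) : ℝ :=
  1 / 2 * ∫ x, (u x * conj (Complex.I * weakDeriv u x)).re * (1 - 1 / ‖u x‖ ^ 2)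

/-- The minimal energy at fixed momentum. -/
noncomputable def Emin (f : ℝ → ℝ) (q : ℝ) : ℝ :=
  sInf {e | ∃ v ∈ nonvanishingEnergySpace f, momentum v = q ∧ energy f v = e}

/-- The momenta `q > 0` such that every function of energy at most `Emin q` stays away from 0. -/
def nonvanishingMomenta (f : ℝ → ℝ) : Set ℝ :=
  {q | 0 < q ∧ ∀ v ∈ energySpace f, energy f v ≤ Emin f q → 0 < ⨅ x, ‖v x‖}

/-- The critical momentum `𝔮_*`. -/
noncomputable def qStar (f : ℝ → ℝ) : ℝ := sSup (nonvanishingMomenta f)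

/-- `u` solves the travelling wave equation `i c u' + u'' + u f(|u|²) = 0`. -/
def IsTravellingWave (f : ℝ → ℝ) (c : ℝ) (u : ℝ → ℂ) : Prop :=
  ContDiff ℝ 2 u ∧
    ∀ x, Complex.I * c * deriv u x + deriv (deriv u) x + u x * (f (‖u x‖ ^ 2) : ℂ) = 0

/-- `v` is a black soliton (kink): a nonconstant stationary solution with modulus tending to 1
at infinity. -/
structure IsKink (f : ℝ → ℝ) (v : ℝ → ℂ) : Prop where
  travellingWave : IsTravellingWave f 0 v
  nonconstant : ¬ ∃ z : ℂ, ∀ x, v x = z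
  tendsto_atTop : Tendsto (fun x => ‖v x‖) atTop (𝓝 1)
  tendsto_atBot : Tendsto (fun x => ‖v x‖) atBot (𝓝 1)

end NLS

/-! Completing the square in |v'|² + F(|v|²) on both sides of a point x₀ bounds E(v) below by 2∫
`speed f` from |v(x₀)| to 1, plus half the integrals of the squared `defect` and of the squared
angular part of v' (`integral_defect_sq_add_le`). Letting |v(x₀)| → 0, a function not bounded away
from zero costs at least `kinkEnergy f`. Black solitons attain this value: their two first integrals
force them to be rotated translates of the solution of w' = `speed f` w. Hence the set defining q_*
consists of the q > 0 with `Emin f q < kinkEnergy f` (`mem_nonvanishingMomenta_iff`).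

Everything else concerns this sublevel set. It is nonempty, because a shallow dip with a gentle
phase twist is cheap. It is bounded (`exists_abs_momentum_le`): below the kink energy, if m = inf
|v| is small, the angular energy is O(m) while ∫ F(|v|²)/|v|² is O(1/m), so Cauchy–Schwarz bounds
the momentum independently of m. It has no largest element, since a small phase twist strictly
raises a positive momentum and changes the energy continuously. So no q ≥ q_* belongs to it, and
`Emin f q` is at least the kink energy there.

Conversely `Emin` never exceeds the kink energy (`IsProfile.exists_energy_le`): lift the zero of the
kink to height ε and twist the phase, mostly near the lifted zero. There (1 - |v|²)/|v| has squared
L² norm at least of order 1/ε, so any prescribed momentum costs only O(ε). -/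

namespace NLS

/-! ### Absolutely continuous functions and indefinite integrals -/

section AbsolutelyContinuous

variable {E : Type*} [NormedAddCommGroup E]

/-- Local absolute continuity on the real line. -/
def LocAbsCont (u : ℝ → E) : Prop := ∀ a b, AbsolutelyContinuousOnInterval u a b

/-- The sums defining absolute continuity compare termwise. This covers norms, indefinite integrals
and locally Lipschitz compositions at once. -/
theorem absolutelyContinuousOnInterval_of_dist_le {F : Type*} [NormedAddCommGroup F]
    {u : ℝ → E} {s : ℝ → F} {a b : ℝ} (hs : AbsolutelyContinuousOnInterval s a b)
    (h : ∀ x ∈ uIcc a b, ∀ y ∈ uIcc a b, dist (u x) (u y) ≤ dist (s x) (s y)) :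
    AbsolutelyContinuousOnInterval u a b := by
  refine squeeze_zero' (Eventually.of_forall fun _ => Finset.sum_nonneg fun _ _ => dist_nonneg)
    ?_ hs
  have : ∀ᶠ (E : ℕ × (ℕ → ℝ × ℝ)) in AbsolutelyContinuousOnInterval.totalLengthFilter ⊓
      𝓟 (AbsolutelyContinuousOnInterval.disjWithin a b),
      E ∈ AbsolutelyContinuousOnInterval.disjWithin a b :=
    eventually_inf_principal.mpr (by simp)
  filter_upwards [this] with I hI
  exact Finset.sum_le_sum fun i hi => h _ (hI.1 i hi).1 _ (hI.1 i hi).2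

theorem LocAbsCont.continuous {u : ℝ → E} (hu : LocAbsCont u) : Continuous u := by
  refine continuous_iff_continuousAt.2 fun x => ?_
  have := (hu (x - 1) (x + 1)).continuousOn
  exact this.continuousAt (by
    rw [uIcc_of_le (by linarith)]; exact Icc_mem_nhds (by linarith) (by linarith))

theorem LocAbsCont.norm {u : ℝ → E} (hu : LocAbsCont u) : LocAbsCont fun x => ‖u x‖ :=
  fun a b => absolutelyContinuousOnInterval_of_dist_le (hu a b) fun _ _ _ _ => by
    rw [dist_eq_norm (u _)]; exact dist_norm_norm_le _ _

theorem intervalIntegrable_of_locallyIntegrable {g : ℝ → E} (hg : LocallyIntegrable g volume)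
    (a b : ℝ) : IntervalIntegrable g volume a b :=
  intervalIntegrable_iff.mpr <|
    (hg.integrableOn_isCompact isCompact_uIcc).mono_set uIoc_subset_uIcc

variable [NormedSpace ℝ E]

theorem locAbsCont_of_contDiff {u : ℝ → E} (hu : ContDiff ℝ 1 u) : LocAbsCont u :=
  fun _ _ => hu.contDiffOn.absolutelyContinuousOnInterval

/-- `u` is an indefinite integral of the locally integrable function `g`. -/
structure IsAntideriv (u g : ℝ → E) : Prop where
  locallyIntegrable : LocallyIntegrable g volume
  integral_eq_sub : ∀ a b, ∫ x in a..b, g x = u b - u a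

theorem IsAntideriv.locAbsCont {u g : ℝ → E} (h : IsAntideriv u g) : LocAbsCont u := by
  intro a b
  have hn := fun a b =>
    (intervalIntegrable_of_locallyIntegrable h.locallyIntegrable a b).norm
  refine absolutelyContinuousOnInterval_of_dist_le
    ((hn a b).absolutelyContinuousOnInterval_intervalIntegral left_mem_uIcc) fun x _ y _ => ?_
  rw [dist_eq_norm, dist_eq_norm, norm_sub_rev, ← h.integral_eq_sub,
    intervalIntegral.integral_interval_sub_left (hn a x) (hn a y), intervalIntegral.integral_symm,
    norm_neg]
  exact intervalIntegral.norm_integral_le_abs_integral_norm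

theorem isAntideriv_integral {g : ℝ → E} (hg : LocallyIntegrable g volume) :
    IsAntideriv (fun x => ∫ t in (0 : ℝ)..x, g t) g := by
  refine ⟨hg, fun a b => ?_⟩
  rw [intervalIntegral.integral_interval_sub_left
    (intervalIntegrable_of_locallyIntegrable hg _ _)
    (intervalIntegrable_of_locallyIntegrable hg _ _)]

variable [CompleteSpace E]

theorem IsAntideriv.ae_hasDerivAt {u g : ℝ → E} (h : IsAntideriv u g) :
    ∀ᵐ x, HasDerivAt u (g x) x := by
  filter_upwards [LocallyIntegrable.ae_hasDerivAt_integral h.locallyIntegrable] with x hx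
  have : u = fun y => (∫ t in (0 : ℝ)..y, g t) + u 0 := by
    ext y; rw [h.integral_eq_sub]; abel
  rw [this]
  exact (hx 0).add_const _

/-- The difference of `u` and the integral of `g` is absolutely continuous with derivative zero
almost everywhere, hence constant. Product and chain rules then need checking only almost
everywhere. -/
theorem LocAbsCont.isAntideriv {u g : ℝ → E} (hu : LocAbsCont u)
    (hg : LocallyIntegrable g volume) (hd : ∀ᵐ x, HasDerivAt u (g x) x) : IsAntideriv u g := by
  refine ⟨hg, fun a b => ?_⟩
  have hi := isAntideriv_integral hg
  have hac : AbsolutelyContinuousOnInterval (fun x => u x - ∫ t in (0 : ℝ)..x, g t) a b :=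
    (hu a b).sub (hi.locAbsCont a b)
  obtain ⟨C, hC⟩ := hac.const_of_ae_hasDerivAt_zero (by
    filter_upwards [hd, hi.ae_hasDerivAt] with x h1 h2 _
    simpa using! h1.sub h2)
  have h1 := hC a left_mem_uIcc
  have h2 := hC b right_mem_uIcc
  rw [hi.integral_eq_sub]
  rw [sub_eq_sub_iff_sub_eq_sub, ← neg_sub (u b), ← neg_sub (u a), h1, h2]

theorem isAntideriv_of_contDiff {u : ℝ → E} (hu : ContDiff ℝ 1 u) : IsAntideriv u (deriv u) :=
  (locAbsCont_of_contDiff hu).isAntideriv (hu.continuous_deriv le_rfl).locallyIntegrable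
    (Eventually.of_forall fun x => (hu.differentiable (by simp) x).hasDerivAt)

theorem LocAbsCont.isAntideriv_deriv {u : ℝ → ℝ} (hu : LocAbsCont u) :
    IsAntideriv u (deriv u) := by
  refine ⟨?_, fun a b => (hu a b).integral_deriv_eq_sub⟩
  rw [locallyIntegrable_iff]
  intro K hK
  obtain ⟨R, hR⟩ := hK.isBounded.subset_closedBall 0
  have h := (hu (-R) R).intervalIntegrable_deriv
  rw [Real.closedBall_eq_Icc, zero_sub, zero_add] at hR
  rcases le_or_gt (-R) R with h' | h'
  · rw [intervalIntegrable_iff_integrableOn_Icc_of_le h'] at h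
    exact h.mono_set hR
  · rw [Icc_eq_empty (not_le.2 h')] at hR
    exact (integrableOn_empty).mono_set hR

end AbsolutelyContinuous

/-! ### Weak derivatives versus indefinite integrals -/

section WeakDerivative

theorem IsAntideriv.isWeakDeriv {u g : ℝ → ℂ} (h : IsAntideriv u g) : IsWeakDeriv u g := by
  have hc := h.locAbsCont.continuous
  refine ⟨hc.locallyIntegrable, h.locallyIntegrable, fun φ hφ hφc => ?_⟩
  have hd : Continuous (deriv φ) := hφ.continuous_deriv (by simp)
  have i1 : Integrable (fun x => deriv φ x • u x) :=
    (hd.smul hc).integrable_of_hasCompactSupport hφc.deriv.smul_right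
  have i2 : Integrable (fun x => φ x • g x) :=
    h.locallyIntegrable.integrable_smul_left_of_hasCompactSupport hφ.continuous hφc
  have hac : LocAbsCont fun x => φ x • u x := fun a b =>
    (locAbsCont_of_contDiff (hφ.of_le (by simp)) a b).smul (h.locAbsCont a b)
  have ha : IsAntideriv (fun x => φ x • u x) (fun x => φ x • g x + deriv φ x • u x) := by
    refine hac.isAntideriv (i2.add i1).locallyIntegrable ?_
    filter_upwards [h.ae_hasDerivAt] with x hx
    exact (hφ.differentiable (by simp) x).hasDerivAt.smul hx
  obtain ⟨R, hR0, hR⟩ := hφc.isCompact.isBounded.subset_ball_lt 0 0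
  have hz : ∀ x, R ≤ |x| → φ x = 0 := fun x hx => by
    by_contra hne
    have := hR (subset_tsupport _ hne)
    rw [Metric.mem_ball, dist_zero_right, Real.norm_eq_abs] at this
    linarith
  have hz' : ∀ x, R < |x| → deriv φ x = 0 := fun x hx => by
    by_contra hne
    have := hR (closure_mono (support_deriv_subset) (subset_closure hne) |>
      (by simpa [tsupport] using ·))
    rw [Metric.mem_ball, dist_zero_right, Real.norm_eq_abs] at this
    linarith
  have hI := ha.integral_eq_sub (-R) R
  rw [hz R (by rw [abs_of_pos hR0]), hz (-R) (by rw [abs_neg, abs_of_pos hR0]), zero_smul,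
    zero_smul, sub_zero, intervalIntegral.integral_of_le (by linarith),
    ← integral_Icc_eq_integral_Ioc, setIntegral_eq_integral_of_forall_compl_eq_zero,
    integral_add i2 i1] at hI
  · rw [add_comm] at hI
    exact eq_neg_of_add_eq_zero_left hI
  · intro x hx
    have : R < |x| := by
      by_contra hlt
      exact hx (abs_le.1 (not_lt.1 hlt))
    rw [hz x this.le, hz' x this, zero_smul, zero_smul, add_zero]

/-- Du Bois-Reymond: subtracting a primitive of `g` leaves a continuous function with zero weak
derivative, which must be constant. -/
theorem IsWeakDeriv.isAntideriv {u g : ℝ → ℂ} (h : IsWeakDeriv u g) (hu : Continuous u) :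
    IsAntideriv u g := by
  have hi := isAntideriv_integral h.locallyIntegrable_deriv
  have hiw := hi.isWeakDeriv
  set V : ℝ → ℂ := fun x => ∫ t in (0 : ℝ)..x, g t with hV
  have hVc : Continuous V := hi.locAbsCont.continuous
  set U : ℝ → ℂ := fun x => u x - V x with hU
  have hUc : Continuous U := hu.sub hVc
  have key : ∀ φ : ℝ → ℝ, ContDiff ℝ ∞ φ → HasCompactSupport φ → ∫ x, deriv φ x • U x = 0 := by
    intro φ hφ hφc
    have hd : Continuous (deriv φ) := hφ.continuous_deriv (by simp)
    have e : (fun x => deriv φ x • U x) = fun x => deriv φ x • u x - deriv φ x • V x := by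
      ext x; rw [hU, smul_sub]
    rw [e, integral_sub (f := fun x => deriv φ x • u x) (g := fun x => deriv φ x • V x) ((hd.smul hu).integrable_of_hasCompactSupport hφc.deriv.smul_right)
      ((hd.smul hVc).integrable_of_hasCompactSupport hφc.deriv.smul_right),
      h.integral_eq φ hφ hφc, hiw.integral_eq φ hφ hφc, sub_self]
  -- A test function of mean zero is the derivative of a test function: its primitive from `-R`
  -- vanishes again beyond `R`.
  have key2 : ∀ ψ : ℝ → ℝ, ContDiff ℝ ∞ ψ → HasCompactSupport ψ → ∫ x, ψ x = 0 →
      ∫ x, ψ x • U x = 0 := by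
    intro ψ hψ hψc h0
    obtain ⟨R, hR0, hR⟩ := hψc.isCompact.isBounded.subset_ball_lt 0 0
    have hz : ∀ x, R ≤ |x| → ψ x = 0 := fun x hx => by
      by_contra hne
      have := hR (subset_tsupport _ hne)
      rw [Metric.mem_ball, dist_zero_right, Real.norm_eq_abs] at this
      linarith
    set φ : ℝ → ℝ := fun x => ∫ t in (-R)..x, ψ t with hφdef
    have hφd : ∀ x, HasDerivAt φ (ψ x) x := fun x =>
      hψ.continuous.integral_hasStrictDerivAt _ _ |>.hasDerivAt
    have hφ' : deriv φ = ψ := funext fun x => (hφd x).deriv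
    have hφs : ContDiff ℝ ∞ φ := by
      rw [contDiff_infty_iff_deriv, hφ']
      exact ⟨fun x => (hφd x).differentiableAt, hψ⟩
    have hφc : HasCompactSupport φ := by
      refine HasCompactSupport.intro (isCompact_Icc (a := -R) (b := R)) fun x hx => ?_
      rcases lt_or_ge x (-R) with h1 | h1
      · show ∫ t in (-R)..x, ψ t = 0
        rw [intervalIntegral.integral_symm, intervalIntegral.integral_of_le h1.le,
          setIntegral_eq_zero_of_forall_eq_zero, neg_zero]
        intro t ht
        exact hz t (by rw [abs_of_nonpos (by linarith [ht.2])]; linarith [ht.2])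
      · have h2 : R < x := by
          by_contra h3; exact hx ⟨h1, not_lt.1 h3⟩
        show ∫ t in (-R)..x, ψ t = 0
        rw [intervalIntegral.integral_of_le h1, ← integral_Icc_eq_integral_Ioc,
          setIntegral_eq_integral_of_forall_compl_eq_zero, h0]
        intro t ht
        refine hz t ?_
        by_contra h3
        exact ht ⟨(abs_lt.1 (not_le.1 h3)).1.le, ((abs_lt.1 (not_le.1 h3)).2.trans h2).le⟩
    have := key φ hφs hφc
    rwa [hφ'] at this
  obtain ⟨ψ₀, hψc, hψs, hψ0, hψ1⟩ : ∃ ψ : ℝ → ℝ, HasCompactSupport ψ ∧ ContDiff ℝ ∞ ψ ∧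
      (∀ x, 0 ≤ ψ x) ∧ ∫ x, ψ x = 1 := by
    let B : ContDiffBump (0 : ℝ) := ⟨1, 2, by norm_num, by norm_num⟩
    exact ⟨B.normed volume, B.hasCompactSupport_normed, B.contDiff_normed,
      B.nonneg_normed, B.integral_normed⟩
  set c : ℂ := ∫ x, ψ₀ x • U x with hc
  have hae : U =ᵐ[volume] fun _ => c := by
    refine ae_eq_of_integral_contDiff_smul_eq hUc.locallyIntegrable
      continuous_const.locallyIntegrable fun ψ hψ hψc' => ?_
    have iψ := hψ.continuous.integrable_of_hasCompactSupport (μ := volume) hψc'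
    have iψ₀ := hψs.continuous.integrable_of_hasCompactSupport (μ := volume) hψc
    -- Subtracting a multiple of the bump `ψ₀` removes the mean, so `U` pairs with every test
    -- function like the constant `c`.
    have e := key2 (fun x => ψ x - (∫ y, ψ y) * ψ₀ x) (hψ.sub (contDiff_const.mul hψs))
      (hψc'.sub (hψc.mul_left))
      (by rw [integral_sub iψ (iψ₀.const_mul _), integral_const_mul, hψ1, mul_one, sub_self])
    have e2 : (fun x => (ψ x - (∫ y, ψ y) * ψ₀ x) • U x) =
        fun x => ψ x • U x - (∫ y, ψ y) • (ψ₀ x • U x) := by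
      ext x; rw [sub_smul, mul_smul]
    rw [e2, integral_sub, integral_smul, ← hc, sub_eq_zero] at e
    · rw [e, integral_smul_const]
    · exact (hψ.continuous.smul hUc).integrable_of_hasCompactSupport hψc'.smul_right
    · exact ((hψs.continuous.smul hUc).integrable_of_hasCompactSupport hψc.smul_right).fun_smul _
  have hall : U = fun _ => c := (hUc.ae_eq_iff_eq volume continuous_const).1 hae
  refine ⟨h.locallyIntegrable_deriv, fun a b => ?_⟩
  rw [hi.integral_eq_sub]
  have h1 : u a - V a = c := congrFun hall a
  have h2 : u b - V b = c := congrFun hall b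
  rw [sub_eq_sub_iff_sub_eq_sub, ← neg_sub (u b), ← neg_sub (u a), h1, h2]

end WeakDerivative

/-- Chain rule for a primitive of a continuous function. -/
theorem IsAntideriv.comp_primitive {ρ r : ℝ → ℝ} (h : IsAntideriv ρ r) {k K : ℝ → ℝ}
    (hk : Continuous k) (hK : ∀ s, HasDerivAt K (k s) s) :
    IsAntideriv (fun x => K (ρ x)) (fun x => k (ρ x) * r x) := by
  have hρ := h.locAbsCont.continuous
  have hK1 : ContDiff ℝ 1 K := by
    rw [contDiff_one_iff_deriv]
    exact ⟨fun s => (hK s).differentiableAt, by rwa [funext fun s => (hK s).deriv]⟩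
  refine LocAbsCont.isAntideriv (fun a b => ?_) ?_ ?_
  · obtain ⟨R, hR⟩ := (isCompact_uIcc (a := a) (b := b)).exists_bound_of_continuousOn
      hρ.continuousOn
    obtain ⟨C, hC⟩ := (isCompact_Icc (a := -R) (b := R)).exists_bound_of_continuousOn
      hk.continuousOn
    refine absolutelyContinuousOnInterval_of_dist_le ((h.locAbsCont a b).const_mul C)
      fun x hx y hy => ?_
    have hC0 : 0 ≤ C := (norm_nonneg _).trans (hC (ρ x) (abs_le.1 (hR x hx)))
    have := (convex_Icc (-R) R).norm_image_sub_le_of_norm_hasDerivWithin_le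
      (fun s _ => (hK s).hasDerivWithinAt) hC (abs_le.1 (hR y hy)) (abs_le.1 (hR x hx))
    rw [dist_eq_norm, dist_eq_norm, ← mul_sub, norm_mul, Real.norm_of_nonneg hC0]
    exact this
  · exact h.locallyIntegrable.continuous_mul (hk.comp hρ)
  · filter_upwards [h.ae_hasDerivAt] with x hx
    exact (hK (ρ x)).comp x hx

/-! ### Polar decomposition of the derivative -/

section EnergySpace

variable {f : ℝ → ℝ} {u g : ℝ → ℂ}

theorem IsAntideriv.weakDeriv_ae_eq (h : IsAntideriv u g) : weakDeriv u =ᵐ[volume] g :=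
  h.isWeakDeriv.weakDeriv_ae_eq

theorem IsAntideriv.mem_energySpace (h : IsAntideriv u g) (hg : MemLp g 2 volume)
    (hF : Integrable (fun x => potential f (‖u x‖ ^ 2)) volume) : u ∈ energySpace f :=
  ⟨⟨h.locAbsCont.continuous, g, h.isWeakDeriv, fun _ _ => hg.restrict _⟩,
    (memLp_congr_ae h.weakDeriv_ae_eq).2 hg, hF⟩

theorem IsAntideriv.energy_eq (h : IsAntideriv u g) :
    energy f u = 1 / 2 * (∫ x, ‖g x‖ ^ 2) + 1 / 2 * ∫ x, potential f (‖u x‖ ^ 2) := by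
  unfold energy
  rw [integral_congr_ae (h.weakDeriv_ae_eq.mono fun x hx => by
    show ‖weakDeriv u x‖ ^ 2 = ‖g x‖ ^ 2
    rw [hx])]

theorem isAntideriv_of_mem_energySpace (hu : u ∈ energySpace f) :
    IsAntideriv u (weakDeriv u) := by
  obtain ⟨⟨hc, g, hg, -⟩, -, -⟩ := hu
  exact hg.weakDeriv.isAntideriv hc

/-- The normal component of `u'` relative to `u`. -/
noncomputable def angular (u g : ℝ → ℂ) (x : ℝ) : ℝ :=
  ((u x).re * (g x).im - (u x).im * (g x).re) / ‖u x‖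

/-- Pointwise, `Re (u * conj (I * g))` is minus `‖u‖` times the angular component; at zeros of `u`
both integrands vanish. -/
theorem IsAntideriv.momentum_eq (h : IsAntideriv u g) :
    momentum u = 1 / 2 * ∫ x, angular u g x * ((1 - ‖u x‖ ^ 2) / ‖u x‖) := by
  unfold momentum
  congr 1
  refine integral_congr_ae (h.weakDeriv_ae_eq.mono fun x hx => ?_)
  simp only [hx, angular]
  rcases eq_or_ne (u x) 0 with h0 | h0
  · simp [h0]
  · have : ‖u x‖ ≠ 0 := norm_ne_zero_iff.2 h0
    simp only [map_mul, Complex.conj_I, Complex.mul_re, Complex.mul_im, Complex.neg_re,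
      Complex.neg_im, Complex.I_re, Complex.I_im, Complex.conj_re, Complex.conj_im]
    field_simp
    ring

theorem norm_sq_eq (z : ℂ) : ‖z‖ ^ 2 = z.re ^ 2 + z.im ^ 2 := by
  rw [← Complex.normSq_eq_norm_sq, Complex.normSq_apply]; ring

/-- The modulus of an absolutely continuous function and its derivative. -/
theorem IsAntideriv.modulus (h : IsAntideriv u g) :
    IsAntideriv (fun x => ‖u x‖) (deriv fun x => ‖u x‖) ∧
    (∀ᵐ x, (deriv (fun x => ‖u x‖) x) ^ 2 + angular u g x ^ 2 ≤ ‖g x‖ ^ 2) ∧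
    (∀ᵐ x, u x ≠ 0 → ‖g x‖ ^ 2 = (deriv (fun x => ‖u x‖) x) ^ 2 + angular u g x ^ 2) := by
  have hn := h.locAbsCont.norm.isAntideriv_deriv
  have key : ∀ᵐ x, u x ≠ 0 →
      ‖g x‖ ^ 2 = (deriv (fun x => ‖u x‖) x) ^ 2 + angular u g x ^ 2 := by
    filter_upwards [hn.ae_hasDerivAt, h.ae_hasDerivAt] with x h1 h2 h0
    have hp : ‖u x‖ ≠ 0 := norm_ne_zero_iff.2 h0
    have hre := (Complex.reCLM.hasFDerivAt.comp_hasDerivAt x h2)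
    have him := (Complex.imCLM.hasFDerivAt.comp_hasDerivAt x h2)
    have e1 := h1.pow 2
    have e2 := (hre.pow 2).add (him.pow 2)
    have e3 : ((fun x => ‖u x‖) ^ 2) =
        ((Complex.reCLM ∘ u) ^ 2 + (Complex.imCLM ∘ u) ^ 2) := by
      ext y; simp [norm_sq_eq]
    rw [e3] at e1
    have e4 := e1.unique e2
    simp only [Function.comp, Complex.reCLM_apply, Complex.imCLM_apply] at e4
    have e5 : ‖u x‖ * deriv (fun x => ‖u x‖) x =
        (u x).re * (g x).re + (u x).im * (g x).im := by
      push_cast at e4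
      norm_num at e4
      linarith
    have e6 : deriv (fun x => ‖u x‖) x =
        ((u x).re * (g x).re + (u x).im * (g x).im) / ‖u x‖ := by
      rw [← e5]; field_simp
    rw [e6, angular, div_pow, div_pow, ← add_div, eq_div_iff (pow_ne_zero 2 hp), norm_sq_eq,
      norm_sq_eq]
    ring
  refine ⟨hn, ?_, key⟩
  filter_upwards [hn.ae_hasDerivAt, key] with x h1 hk
  rcases eq_or_ne (u x) 0 with h0 | h0
  -- At a zero the modulus is minimal, so its derivative vanishes, and `angular` is `0` by division
  -- by zero. Only an inequality is claimed here.
  · have hmin : IsLocalMin (fun x => ‖u x‖) x :=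
      Eventually.of_forall fun y => by simp [h0]
    rw [hmin.hasDerivAt_eq_zero h1]
    simp [angular, h0]
  · exact (hk h0).ge

end EnergySpace

/-! ### Coercive potentials and the profile speed -/

/-- Regular potentials that are coercive around the vacuum `|u| = 1`. -/
structure Coercive (f : ℝ → ℝ) (lam : ℝ) : Prop where
  contDiff : ContDiff ℝ 3 f
  pos : 0 < lam
  le_potential : ∀ ρ : ℝ, 0 ≤ ρ → lam * (1 - ρ) ^ 2 ≤ potential f ρ

/-- The speed `√F(s²)` of the kink profile. -/
noncomputable def speed (f : ℝ → ℝ) (s : ℝ) : ℝ := √(potential f (s ^ 2))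

/-- The energy of the black soliton. -/
noncomputable def kinkEnergy (f : ℝ → ℝ) : ℝ := 2 * ∫ s in (0 : ℝ)..1, speed f s

theorem hasDerivAt_potential {f : ℝ → ℝ} (hf : Continuous f) (ρ : ℝ) :
    HasDerivAt (potential f) (-f ρ) ρ := by
  have : potential f = fun ρ => - ∫ r in (1 : ℝ)..ρ, f r := by
    ext ρ; rw [potential, intervalIntegral.integral_symm]
  rw [this]
  exact (hf.integral_hasStrictDerivAt 1 ρ).hasDerivAt.neg

theorem continuous_potential {f : ℝ → ℝ} (hf : Continuous f) : Continuous (potential f) :=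
  continuous_iff_continuousAt.2 fun ρ => (hasDerivAt_potential hf ρ).continuousAt

theorem continuous_speed {f : ℝ → ℝ} (hf : Continuous f) : Continuous (speed f) :=
  Real.continuous_sqrt.comp ((continuous_potential hf).comp (continuous_pow 2))

theorem speed_nonneg (f : ℝ → ℝ) (s : ℝ) : 0 ≤ speed f s := Real.sqrt_nonneg _

theorem potential_one (f : ℝ → ℝ) : potential f 1 = 0 := by simp [potential]

theorem Coercive.continuous {f : ℝ → ℝ} {lam : ℝ} (H : Coercive f lam) : Continuous f :=
  H.contDiff.continuous

theorem Coercive.potential_sq_nonneg {f : ℝ → ℝ} {lam : ℝ} (H : Coercive f lam) (s : ℝ) :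
    0 ≤ potential f (s ^ 2) :=
  (mul_nonneg H.pos.le (sq_nonneg _)).trans (H.le_potential _ (sq_nonneg s))

theorem Coercive.speed_sq {f : ℝ → ℝ} {lam : ℝ} (H : Coercive f lam) (s : ℝ) :
    speed f s ^ 2 = potential f (s ^ 2) := Real.sq_sqrt (H.potential_sq_nonneg s)

theorem Coercive.speed_pos {f : ℝ → ℝ} {lam : ℝ} (H : Coercive f lam) {s : ℝ} (hs : s ^ 2 ≠ 1) :
    0 < speed f s := by
  refine Real.sqrt_pos.2 (lt_of_lt_of_le ?_ (H.le_potential _ (sq_nonneg s)))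
  exact mul_pos H.pos (sq_pos_of_ne_zero (sub_ne_zero.2 hs.symm))

theorem Coercive.sqrt_mul_abs_le_speed {f : ℝ → ℝ} {lam : ℝ} (H : Coercive f lam) (s : ℝ) :
    √lam * |1 - s ^ 2| ≤ speed f s := by
  rw [speed, ← Real.sqrt_sq_eq_abs, ← Real.sqrt_mul H.pos.le]
  exact Real.sqrt_le_sqrt (H.le_potential _ (sq_nonneg s))

/-! ### Behaviour of the modulus at infinity -/

section Limits

/-- By Chebyshev the set where `c ≤ φ` has finite measure, so it is not in `l`. -/
theorem frequently_lt_of_integrable {l : Filter ℝ} (hl : ∀ s ∈ l, volume s = ⊤) {φ : ℝ → ℝ}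
    (hφ : Integrable φ) {c : ℝ} (hc : 0 < c) : ∃ᶠ x in l, φ x < c := by
  intro hcon
  have h1 := hl _ hcon
  have h2 := hφ.measure_ge_lt_top hc
  simp only [not_lt] at h1
  exact h2.ne h1

theorem volume_eq_top_of_mem_atTop (s : Set ℝ) (hs : s ∈ (atTop : Filter ℝ)) :
    volume s = ⊤ := by
  obtain ⟨a, ha⟩ := mem_atTop_sets.1 hs
  exact top_unique (Real.volume_Ici (a := a) ▸ measure_mono ha)

theorem volume_eq_top_of_mem_atBot (s : Set ℝ) (hs : s ∈ (atBot : Filter ℝ)) :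
    volume s = ⊤ := by
  obtain ⟨a, ha⟩ := mem_atBot_sets.1 hs
  exact top_unique (Real.volume_Iic (a := a) ▸ measure_mono ha)

/-- Integrability of the potential makes it small at arbitrarily distant points, where coercivity
puts the modulus near 1. A cluster point suffices, since primitives evaluated along the modulus
converge anyway. -/
theorem Coercive.mapClusterPt_one {f : ℝ → ℝ} {lam : ℝ} (H : Coercive f lam) {ρ : ℝ → ℝ}
    (h0 : ∀ x, 0 ≤ ρ x) (hF : Integrable fun x => potential f (ρ x ^ 2)) {l : Filter ℝ}
    (hl : ∀ s ∈ l, volume s = ⊤) : MapClusterPt 1 l ρ := by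
  rw [mapClusterPt_iff_frequently]
  intro s hs
  obtain ⟨ε, hε, hs⟩ := Metric.mem_nhds_iff.1 hs
  refine (frequently_lt_of_integrable hl hF (mul_pos H.pos (pow_pos hε 2))).mono fun x hx => hs ?_
  rw [Metric.mem_ball, Real.dist_eq]
  have h1 := (H.le_potential _ (sq_nonneg (ρ x))).trans_lt hx
  have h2 : (1 - ρ x ^ 2) ^ 2 < ε ^ 2 := lt_of_mul_lt_mul_left h1 H.pos.le
  refine abs_lt_of_sq_lt_sq (lt_of_le_of_lt ?_ h2) hε.le
  have : (1 - ρ x ^ 2) ^ 2 = (ρ x - 1) ^ 2 * (1 + ρ x) ^ 2 := by ring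
  rw [this]
  exact le_mul_of_one_le_right (sq_nonneg _) (one_le_pow₀ (by linarith [h0 x]))

theorem eq_of_mapClusterPt_of_tendsto {l : Filter ℝ} {ρ K : ℝ → ℝ} {a L : ℝ}
    (h : MapClusterPt a l ρ) (hK : Continuous K) (hL : Tendsto (fun x => K (ρ x)) l (𝓝 L)) :
    L = K a := by
  have h1 : MapClusterPt (K a) l (K ∘ ρ) := h.continuousAt_comp hK.continuousAt
  have h2 : ClusterPt (K a) (𝓝 L) := ClusterPt.mono h1 hL
  exact (eq_of_nhds_neBot h2).symm

/-- Change of variables on the two half lines for a modulus tending to `1`. -/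
theorem IsAntideriv.integral_sign_mul {ρ r k : ℝ → ℝ} (h : IsAntideriv ρ r) (hk : Continuous k)
    (hi : Integrable fun x => k (ρ x) * r x) (htop : MapClusterPt 1 atTop ρ)
    (hbot : MapClusterPt 1 atBot ρ) (x₀ : ℝ) :
    ∫ x, (if x₀ < x then 1 else -1) * (k (ρ x) * r x) = 2 * ∫ s in (ρ x₀)..1, k s := by
  set K : ℝ → ℝ := fun s => ∫ t in (0 : ℝ)..s, k t with hKdef
  have hK : ∀ s, HasDerivAt K (k s) s := fun s => (hk.integral_hasStrictDerivAt 0 s).hasDerivAt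
  have hKc : Continuous K := continuous_iff_continuousAt.2 fun s => (hK s).continuousAt
  have ha := (h.comp_primitive hk hK).integral_eq_sub
  have e0 : ∫ s in (ρ x₀)..1, k s = K 1 - K (ρ x₀) := by
    rw [hKdef, intervalIntegral.integral_interval_sub_left (hk.intervalIntegrable _ _)
      (hk.intervalIntegrable _ _)]
  have e1 : ∫ x in Ioi x₀, k (ρ x) * r x = K 1 - K (ρ x₀) := by
    have h1 := intervalIntegral_tendsto_integral_Ioi x₀ hi.integrableOn tendsto_id
    simp only [id, ha] at h1
    have h2 : Tendsto (fun x => K (ρ x)) atTop (𝓝 ((∫ x in Ioi x₀, k (ρ x) * r x) + K (ρ x₀))) := by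
      simpa using h1.add_const (K (ρ x₀))
    linarith [eq_of_mapClusterPt_of_tendsto htop hKc h2]
  have e2 : ∫ x in Iic x₀, k (ρ x) * r x = K (ρ x₀) - K 1 := by
    have h1 := intervalIntegral_tendsto_integral_Iic x₀ hi.integrableOn tendsto_id
    simp only [id, ha] at h1
    have h2 : Tendsto (fun x => K (ρ x)) atBot (𝓝 (K (ρ x₀) - ∫ x in Iic x₀, k (ρ x) * r x)) := by
      simpa using h1.const_sub (K (ρ x₀))
    linarith [eq_of_mapClusterPt_of_tendsto hbot hKc h2]
  have hs : Integrable fun x => (if x₀ < x then (1 : ℝ) else -1) * (k (ρ x) * r x) := by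
    refine hi.bdd_mul (c := 1) ?_ (Eventually.of_forall fun x => by split_ifs <;> simp)
    exact (Measurable.ite measurableSet_Ioi measurable_const
      measurable_const).aestronglyMeasurable
  rw [← intervalIntegral.integral_Iic_add_Ioi (b := x₀) hs.integrableOn hs.integrableOn, e0,
    setIntegral_congr_fun (g := fun x => k (ρ x) * r x) measurableSet_Ioi
      (fun x (hx : x₀ < x) => by simp [hx]),
    setIntegral_congr_fun (g := fun x => - (k (ρ x) * r x)) measurableSet_Iic
      (fun x (hx : x ≤ x₀) => by simp [not_lt.2 hx]), e1, integral_neg, e2]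
  ring

end Limits

/-! ### Energy lower bounds and bounded momentum below the kink energy -/

section MomentumBound

variable {f : ℝ → ℝ} {lam : ℝ} {v : ℝ → ℂ}

/-- The derivative of the modulus. -/
noncomputable def radial (v : ℝ → ℂ) : ℝ → ℝ := deriv fun x => ‖v x‖

theorem bddBelow_range_norm (v : ℝ → ℂ) : BddBelow (range fun x => ‖v x‖) :=
  ⟨0, by rintro _ ⟨x, rfl⟩; exact norm_nonneg _⟩

theorem integrable_norm_sq_of_mem (hv : v ∈ energySpace f) :
    Integrable fun x => ‖weakDeriv v x‖ ^ 2 :=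
  (memLp_two_iff_integrable_sq_norm hv.2.1.aestronglyMeasurable).1 hv.2.1

theorem memLp_of_sq_le {φ : ℝ → ℝ} {ψ : ℝ → ℝ} (hφ : AEStronglyMeasurable φ volume)
    (hψ : Integrable ψ) (h : ∀ᵐ x, φ x ^ 2 ≤ ψ x) : MemLp φ 2 volume := by
  refine (memLp_two_iff_integrable_sq hφ).2 (hψ.mono' (hφ.pow 2) (h.mono fun x hx => ?_))
  rwa [Real.norm_of_nonneg (sq_nonneg _)]

theorem memLp_radial (hv : v ∈ energySpace f) : MemLp (radial v) 2 volume := by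
  obtain ⟨h1, h2, -⟩ := (isAntideriv_of_mem_energySpace hv).modulus
  exact memLp_of_sq_le h1.locallyIntegrable.aestronglyMeasurable (integrable_norm_sq_of_mem hv)
    (h2.mono fun x hx => (le_add_of_nonneg_right (sq_nonneg _)).trans hx)

theorem aestronglyMeasurable_angular {u g : ℝ → ℂ} (hu : AEStronglyMeasurable u volume)
    (hg : AEStronglyMeasurable g volume) : AEStronglyMeasurable (angular u g) volume := by
  have h1 := hu.aemeasurable
  have h2 := hg.aemeasurable
  refine AEMeasurable.aestronglyMeasurable ?_
  unfold angular
  exact (((Complex.measurable_re.comp_aemeasurable h1).mul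
    (Complex.measurable_im.comp_aemeasurable h2)).sub
    ((Complex.measurable_im.comp_aemeasurable h1).mul
    (Complex.measurable_re.comp_aemeasurable h2))).div h1.norm

theorem memLp_angular (hv : v ∈ energySpace f) : MemLp (angular v (weakDeriv v)) 2 volume := by
  have ha := isAntideriv_of_mem_energySpace hv
  obtain ⟨-, h2, -⟩ := ha.modulus
  exact memLp_of_sq_le (aestronglyMeasurable_angular
    ha.locAbsCont.continuous.aestronglyMeasurable
    ha.locallyIntegrable.aestronglyMeasurable) (integrable_norm_sq_of_mem hv)
    (h2.mono fun x hx => (le_add_of_nonneg_left (sq_nonneg _)).trans hx)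

namespace Coercive

theorem memLp_speed (H : Coercive f lam) (hv : v ∈ energySpace f) :
    MemLp (fun x => speed f ‖v x‖) 2 volume :=
  memLp_of_sq_le ((continuous_speed H.continuous).comp
    (isAntideriv_of_mem_energySpace hv).locAbsCont.continuous.norm).aestronglyMeasurable hv.2.2
    (Eventually.of_forall fun _ => (H.speed_sq _).le)

theorem integral_sign_mul (H : Coercive f lam) (hv : v ∈ energySpace f) {k : ℝ → ℝ}
    (hk : Continuous k) (hi : Integrable fun x => k ‖v x‖ * radial v x) (x₀ : ℝ) :
    ∫ x, (if x₀ < x then 1 else -1) * (k ‖v x‖ * radial v x) = 2 * ∫ s in ‖v x₀‖..1, k s :=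
  (isAntideriv_of_mem_energySpace hv).modulus.1.integral_sign_mul hk hi
    (H.mapClusterPt_one (fun _ => norm_nonneg _) hv.2.2 volume_eq_top_of_mem_atTop)
    (H.mapClusterPt_one (fun _ => norm_nonneg _) hv.2.2 volume_eq_top_of_mem_atBot) x₀

end Coercive

/-- The defect of the modulus of `v` from solving the kink equation on both sides of `x₀`. -/
noncomputable def defect (f : ℝ → ℝ) (v : ℝ → ℂ) (x₀ x : ℝ) : ℝ :=
  speed f ‖v x‖ - (if x₀ < x then 1 else -1) * radial v x

theorem sign_sq (x₀ x : ℝ) : (if x₀ < x then (1 : ℝ) else -1) ^ 2 = 1 := by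
  split_ifs <;> norm_num

theorem integrable_sign_mul {φ : ℝ → ℝ} (hφ : Integrable φ) (x₀ : ℝ) :
    Integrable fun x => (if x₀ < x then (1 : ℝ) else -1) * φ x :=
  hφ.bdd_mul (c := 1) (Measurable.ite measurableSet_Ioi measurable_const
    measurable_const).aestronglyMeasurable (Eventually.of_forall fun _ => by split_ifs <;> simp)

namespace Coercive

theorem integrable_defect_sq (H : Coercive f lam) (hv : v ∈ energySpace f) (x₀ : ℝ) :
    Integrable fun x => defect f v x₀ x ^ 2 := by
  have h1 := H.memLp_speed hv
  have h2 := memLp_radial hv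
  have : (fun x => defect f v x₀ x ^ 2) = fun x => speed f ‖v x‖ ^ 2 + radial v x ^ 2
      - 2 * ((if x₀ < x then 1 else -1) * (speed f ‖v x‖ * radial v x)) := by
    ext x
    unfold defect
    linear_combination radial v x ^ 2 * sign_sq x₀ x
  rw [this]
  exact (h1.integrable_sq.add h2.integrable_sq).sub
    ((integrable_sign_mul (h1.integrable_mul h2) x₀).const_mul 2)

/-- The energy exceeds the modulus cost by the defect and the angular part. -/
theorem integral_defect_sq_add_le (H : Coercive f lam) (hv : v ∈ energySpace f) (x₀ : ℝ) :
    (∫ x, defect f v x₀ x ^ 2) + ∫ x, angular v (weakDeriv v) x ^ 2 ≤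
      2 * energy f v - 4 * ∫ s in ‖v x₀‖..1, speed f s := by
  have h1 := H.memLp_speed hv
  have h2 := memLp_radial hv
  have h3 := memLp_angular hv
  have h4 : Integrable fun x => speed f ‖v x‖ * radial v x := h1.integrable_mul h2
  have h6 : Integrable fun x => speed f ‖v x‖ ^ 2 + radial v x ^ 2 :=
    h1.integrable_sq.add h2.integrable_sq
  have e : ∀ x, defect f v x₀ x ^ 2 = speed f ‖v x‖ ^ 2 + radial v x ^ 2
      - 2 * ((if x₀ < x then 1 else -1) * (speed f ‖v x‖ * radial v x)) := fun x => by
    unfold defect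
    linear_combination radial v x ^ 2 * sign_sq x₀ x
  simp_rw [e]
  rw [integral_sub h6
    ((integrable_sign_mul h4 x₀).const_mul 2), integral_const_mul,
    H.integral_sign_mul hv (continuous_speed H.continuous) h4,
    integral_add h1.integrable_sq h2.integrable_sq]
  have h5 : (∫ x, radial v x ^ 2) + ∫ x, angular v (weakDeriv v) x ^ 2 ≤
      ∫ x, ‖weakDeriv v x‖ ^ 2 := by
    rw [← integral_add h2.integrable_sq h3.integrable_sq]
    exact integral_mono_ae (h2.integrable_sq.add h3.integrable_sq)
      (integrable_norm_sq_of_mem hv) (isAntideriv_of_mem_energySpace hv).modulus.2.1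
  simp_rw [H.speed_sq]
  unfold energy
  linarith

theorem two_mul_integral_speed_le_energy (H : Coercive f lam) (hv : v ∈ energySpace f) (x₀ : ℝ) :
    2 * ∫ s in ‖v x₀‖..1, speed f s ≤ energy f v := by
  have h1 := H.integral_defect_sq_add_le hv x₀
  have h2 : 0 ≤ ∫ x, defect f v x₀ x ^ 2 := integral_nonneg fun _ => sq_nonneg _
  have h3 : 0 ≤ ∫ x, angular v (weakDeriv v) x ^ 2 := integral_nonneg fun _ => sq_nonneg _
  linarith

theorem energy_nonneg (H : Coercive f lam) (v : ℝ → ℂ) : 0 ≤ energy f v := by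
  unfold energy
  have h1 : 0 ≤ ∫ x, ‖weakDeriv v x‖ ^ 2 := integral_nonneg fun _ => sq_nonneg _
  have h2 : 0 ≤ ∫ x, potential f (‖v x‖ ^ 2) := integral_nonneg fun _ => H.potential_sq_nonneg _
  linarith

/-- A function that is not bounded away from zero costs at least the energy of the kink. -/
theorem kinkEnergy_le_energy (H : Coercive f lam) (hv : v ∈ energySpace f)
    (h0 : ¬ 0 < ⨅ x, ‖v x‖) : kinkEnergy f ≤ energy f v := by
  have hex : ∀ n : ℕ, ∃ x, ‖v x‖ < 1 / ((n : ℝ) + 1) := fun n => by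
    refine exists_lt_of_ciInf_lt ((not_lt.1 h0).trans_lt ?_)
    positivity
  choose x hx using hex
  have hlim : Tendsto (fun n => ‖v (x n)‖) atTop (𝓝 0) :=
    squeeze_zero (fun _ => norm_nonneg _) (fun n => (hx n).le)
      tendsto_one_div_add_atTop_nhds_zero_nat
  have hc : Continuous fun s : ℝ => 2 * ∫ t in s..1, speed f t := by
    have : (fun s : ℝ => 2 * ∫ t in s..1, speed f t) =
        fun s : ℝ => 2 * -∫ t in (1 : ℝ)..s, speed f t := by
      ext s; rw [intervalIntegral.integral_symm]
    rw [this]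
    exact ((intervalIntegral.continuous_primitive
      (fun a b => (continuous_speed H.continuous).intervalIntegrable a b) 1).neg).const_mul 2
  exact le_of_tendsto ((hc.tendsto 0).comp hlim)
    (Eventually.of_forall fun n => H.two_mul_integral_speed_le_energy hv (x n))

theorem exists_speed_le (H : Coercive f lam) : ∃ C, 0 ≤ C ∧ ∀ s ∈ Icc (0 : ℝ) 1, speed f s ≤ C := by
  obtain ⟨C, hC⟩ := (isCompact_Icc (a := (0 : ℝ)) (b := 1)).exists_bound_of_continuousOn
    (continuous_speed H.continuous).continuousOn
  exact ⟨C, (norm_nonneg _).trans (hC 0 (by simp)), fun s hs => (le_abs_self _).trans (hC s hs)⟩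

theorem abs_integrand_le (H : Coercive f lam) (a : ℝ) {s : ℝ} (hs : 0 < s) :
    ‖a * ((1 - s ^ 2) / s)‖ ≤ (√lam)⁻¹ * (|a| * (speed f s / s)) := by
  have hl : 0 < √lam := Real.sqrt_pos.2 H.pos
  have h1 := H.sqrt_mul_abs_le_speed s
  rw [Real.norm_eq_abs, abs_mul, abs_div, abs_of_pos hs]
  have h2 : |1 - s ^ 2| ≤ (√lam)⁻¹ * speed f s := by
    rw [inv_mul_eq_div, le_div_iff₀ hl]; linarith
  calc |a| * (|1 - s ^ 2| / s) ≤ |a| * ((√lam)⁻¹ * speed f s / s) := by gcongr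
    _ = _ := by ring

/-- Dividing by the modulus costs at most a factor 2 here, and Young's inequality puts the product
of angular part and speed under the energy density. -/
theorem abs_momentum_le_of_half_le (H : Coercive f lam) (hv : v ∈ energySpace f)
    (hhalf : ∀ x, 1 / 2 ≤ ‖v x‖) : |momentum v| ≤ (√lam)⁻¹ * energy f v := by
  have ha := isAntideriv_of_mem_energySpace hv
  have h1 := (H.memLp_speed hv).integrable_sq
  have h3 := (memLp_angular hv).integrable_sq
  have hl : 0 < (√lam)⁻¹ := inv_pos.2 (Real.sqrt_pos.2 H.pos)
  rw [ha.momentum_eq, abs_mul, abs_of_pos (by norm_num : (0 : ℝ) < 1 / 2)]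
  have hb : ‖∫ x, angular v (weakDeriv v) x * ((1 - ‖v x‖ ^ 2) / ‖v x‖)‖ ≤
      ∫ x, (√lam)⁻¹ * (angular v (weakDeriv v) x ^ 2 + speed f ‖v x‖ ^ 2) := by
    refine norm_integral_le_of_norm_le ((h3.add h1).const_mul _) (Eventually.of_forall fun x => ?_)
    have hp : 0 < ‖v x‖ := lt_of_lt_of_le (by norm_num) (hhalf x)
    refine (H.abs_integrand_le _ hp).trans (mul_le_mul_of_nonneg_left ?_ hl.le)
    have h4 : speed f ‖v x‖ / ‖v x‖ ≤ 2 * speed f ‖v x‖ := by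
      rw [div_le_iff₀ hp]
      nlinarith [speed_nonneg f ‖v x‖, hhalf x]
    calc |angular v (weakDeriv v) x| * (speed f ‖v x‖ / ‖v x‖)
        ≤ |angular v (weakDeriv v) x| * (2 * speed f ‖v x‖) := by gcongr
      _ ≤ |angular v (weakDeriv v) x| ^ 2 + speed f ‖v x‖ ^ 2 := by
        nlinarith [sq_nonneg (|angular v (weakDeriv v) x| - speed f ‖v x‖)]
      _ = _ := by rw [sq_abs]
  rw [integral_const_mul, integral_add h3 h1] at hb
  have h5 := integral_mono_ae h3 (integrable_norm_sq_of_mem hv)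
    (ha.modulus.2.1.mono fun x hx => (le_add_of_nonneg_left (sq_nonneg _)).trans hx)
  simp_rw [H.speed_sq] at hb
  rw [Real.norm_eq_abs] at hb
  unfold energy
  nlinarith

/-- Bounding the speed by `C` leaves the integral of `t⁻²`. The truncation `max t m` changes nothing
on `[s, 1]`, but makes the integrand continuous on the line, as the change of variables requires. -/
theorem integral_speed_div_sq_le (H : Coercive f lam) {C m s : ℝ} (hC0 : 0 ≤ C)
    (hC : ∀ s ∈ Icc (0 : ℝ) 1, speed f s ≤ C) (hm : 0 < m) (hms : m ≤ s) (hs : s ≤ 1) :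
    ∫ t in s..1, speed f t / max t m ^ 2 ≤ C / m := by
  have hs0 : 0 < s := hm.trans_le hms
  have hne : ∀ t : ℝ, max t m ^ 2 ≠ 0 := fun t => pow_ne_zero 2 (lt_max_of_lt_right hm).ne'
  have hd : ∀ t ∈ uIcc s 1, HasDerivAt (fun t : ℝ => C * -t⁻¹) (C * (t ^ 2)⁻¹) t := fun t ht => by
    rw [uIcc_of_le hs] at ht
    simpa using ((hasDerivAt_inv (hs0.trans_le ht.1).ne').neg).const_mul C
  have hint : IntervalIntegrable (fun t : ℝ => C * (t ^ 2)⁻¹) volume s 1 := by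
    refine ContinuousOn.intervalIntegrable (continuousOn_const.mul
      ((continuousOn_pow 2).inv₀ fun t ht => ?_))
    rw [uIcc_of_le hs] at ht
    exact pow_ne_zero 2 (hs0.trans_le ht.1).ne'
  calc ∫ t in s..1, speed f t / max t m ^ 2 ≤ ∫ t in s..1, C * (t ^ 2)⁻¹ := by
        refine intervalIntegral.integral_mono_on hs
          (((continuous_speed H.continuous).div ((continuous_id.max continuous_const).pow 2)
            hne).intervalIntegrable _ _) hint fun t ht => ?_
        have ht0 : 0 < t := hs0.trans_le ht.1
        rw [max_eq_left (hms.trans ht.1), div_eq_mul_inv]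
        exact mul_le_mul_of_nonneg_right (hC t ⟨ht0.le, ht.2⟩) (by positivity)
    _ = C * (s⁻¹ - 1) := by
        rw [intervalIntegral.integral_eq_sub_of_hasDerivAt hd hint]; norm_num; ring
    _ ≤ C / m := by
        rw [div_eq_mul_inv]
        refine mul_le_mul_of_nonneg_left ?_ hC0
        have := inv_anti₀ hm hms
        linarith

/-- With `m` the infimum of the modulus, the angular integral `W` is O(m) and the singular integral
`J` is O(1/m), so `m` cancels in the bound on their product. -/
theorem abs_momentum_le_of_lt_half (H : Coercive f lam) {C : ℝ} (hC0 : 0 ≤ C)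
    (hC : ∀ s ∈ Icc (0 : ℝ) 1, speed f s ≤ C) (hv : v ∈ nonvanishingEnergySpace f)
    (hE : energy f v < kinkEnergy f) (hhalf : ∃ x, ‖v x‖ < 1 / 2) :
    |momentum v| ≤ (√lam)⁻¹ * (5 * C) := by
  obtain ⟨hv, hm⟩ := hv
  set m : ℝ := ⨅ x, ‖v x‖ with hmdef
  have hmle : ∀ x, m ≤ ‖v x‖ := fun x => ciInf_le (bddBelow_range_norm v) x
  have hm2 : m < 1 / 2 := let ⟨x, hx⟩ := hhalf; (hmle x).trans_lt hx
  obtain ⟨x₀, hx₀⟩ : ∃ x, ‖v x‖ < 2 * m := exists_lt_of_ciInf_lt (by rw [← hmdef]; linarith)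
  have hx₀1 : ‖v x₀‖ ≤ 1 := by linarith
  have hpos : ∀ x, 0 < ‖v x‖ := fun x => hm.trans_le (hmle x)
  have ha := isAntideriv_of_mem_energySpace hv
  have hsc := continuous_speed H.continuous
  have h1 := H.memLp_speed hv
  have h2 := memLp_radial hv
  have h3 := (memLp_angular hv).integrable_sq
  have hD := H.integrable_defect_sq hv x₀
  have hl : 0 < (√lam)⁻¹ := inv_pos.2 (Real.sqrt_pos.2 H.pos)
  set D := ∫ x, defect f v x₀ x ^ 2 with hDdef
  set W := ∫ x, angular v (weakDeriv v) x ^ 2 with hWdef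
  -- The modulus cost from `‖v x₀‖` to 1 misses only the integral of the speed over `[0, ‖v x₀‖]`,
  -- of size at most `2 * C * m`.
  have hDW : D + W ≤ 8 * C * m := by
    have e1 := H.integral_defect_sq_add_le hv x₀
    have e2 := intervalIntegral.integral_add_adjacent_intervals (μ := volume)
      (hsc.intervalIntegrable 0 ‖v x₀‖) (hsc.intervalIntegrable ‖v x₀‖ 1)
    have e3 : ∫ s in (0 : ℝ)..‖v x₀‖, speed f s ≤ C * ‖v x₀‖ := by
      have := intervalIntegral.integral_mono_on (hpos x₀).le (hsc.intervalIntegrable _ _)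
        ((continuous_const (y := C)).intervalIntegrable (μ := volume) _ _)
        (fun s hs => hC s ⟨hs.1, hs.2.trans hx₀1⟩)
      simpa [mul_comm] using this
    have e4 : C * ‖v x₀‖ ≤ C * (2 * m) := mul_le_mul_of_nonneg_left hx₀.le hC0
    unfold kinkEnergy at hE
    linarith
  have hD0 : 0 ≤ D := integral_nonneg fun _ => sq_nonneg _
  have hW0 : 0 ≤ W := integral_nonneg fun _ => sq_nonneg _
  set k : ℝ → ℝ := fun t => speed f t / max t m ^ 2 with hk
  have hkc : Continuous k := hsc.div ((continuous_id.max continuous_const).pow 2)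
    fun t => pow_ne_zero 2 (lt_max_of_lt_right hm).ne'
  have hke : ∀ x, k ‖v x‖ = speed f ‖v x‖ / ‖v x‖ ^ 2 := fun x => by
    simp only [hk, max_eq_left (hmle x)]
  have hinv : ∀ x, ‖(‖v x‖ ^ 2)⁻¹‖ ≤ (m ^ 2)⁻¹ := fun x => by
    rw [Real.norm_of_nonneg (by positivity)]
    exact inv_anti₀ (by positivity) (pow_le_pow_left₀ hm.le (hmle x) 2)
  have hmeas : AEStronglyMeasurable (fun x => (‖v x‖ ^ 2)⁻¹) volume :=
    ((ha.locAbsCont.continuous.norm.pow 2).inv₀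
      fun x => pow_ne_zero 2 (hpos x).ne').aestronglyMeasurable
  have hki : Integrable fun x => k ‖v x‖ * radial v x := by
    have := (h1.integrable_mul h2).bdd_mul hmeas (Eventually.of_forall hinv)
    refine this.congr (Eventually.of_forall fun x => ?_)
    simp only [hke, Pi.mul_apply]
    ring
  have hJi : Integrable fun x => (speed f ‖v x‖ / ‖v x‖) ^ 2 := by
    have := h1.integrable_sq.bdd_mul hmeas (Eventually.of_forall hinv)
    refine this.congr (Eventually.of_forall fun x => ?_)
    simp only [div_pow]
    ring
  set J := ∫ x, (speed f ‖v x‖ / ‖v x‖) ^ 2 with hJ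
  -- One factor of the speed is written as signed radial derivative plus defect. The first part
  -- integrates exactly; the second yields half of `J`, absorbed on the left, and a multiple of `D /
  -- m ^ 2`.
  have hJle : J ≤ 12 * C / m := by
    have e1 : J ≤ ∫ x, ((if x₀ < x then 1 else -1) * (k ‖v x‖ * radial v x)
        + (1 / 2 * (speed f ‖v x‖ / ‖v x‖) ^ 2 + 1 / (2 * m ^ 2) * defect f v x₀ x ^ 2)) := by
      refine integral_mono hJi ((integrable_sign_mul hki x₀).add
        ((hJi.const_mul _).add (hD.const_mul _))) fun x => ?_
      simp only [hke]
      set σ : ℝ := if x₀ < x then 1 else -1 with hσ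
      have hp := hpos x
      have i1 : defect f v x₀ x ^ 2 / ‖v x‖ ^ 2 ≤ 1 / m ^ 2 * defect f v x₀ x ^ 2 := by
        have := mul_le_mul_of_nonneg_left ((le_abs_self _).trans (hinv x))
          (sq_nonneg (defect f v x₀ x))
        rw [div_eq_mul_inv, one_div, mul_comm _ (defect f v x₀ x ^ 2)]
        exact this
      have i2 : defect f v x₀ x = speed f ‖v x‖ - σ * radial v x := rfl
      have i3 : (speed f ‖v x‖ / ‖v x‖) ^ 2 = σ * (speed f ‖v x‖ / ‖v x‖ ^ 2 * radial v x)
          + (speed f ‖v x‖ / ‖v x‖) * (defect f v x₀ x / ‖v x‖) := by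
        rw [i2]; field_simp; ring
      have i4 : (speed f ‖v x‖ / ‖v x‖) * (defect f v x₀ x / ‖v x‖) ≤
          1 / 2 * (speed f ‖v x‖ / ‖v x‖) ^ 2 + 1 / 2 * (defect f v x₀ x ^ 2 / ‖v x‖ ^ 2) := by
        rw [← div_pow]
        nlinarith [sq_nonneg (speed f ‖v x‖ / ‖v x‖ - defect f v x₀ x / ‖v x‖)]
      have i5 : 1 / (2 * m ^ 2) * defect f v x₀ x ^ 2 =
          1 / 2 * (1 / m ^ 2 * defect f v x₀ x ^ 2) := by
        field_simp
      linarith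
    have hJD : Integrable fun x => 1 / 2 * (speed f ‖v x‖ / ‖v x‖) ^ 2 +
        1 / (2 * m ^ 2) * defect f v x₀ x ^ 2 := (hJi.const_mul _).add (hD.const_mul _)
    rw [integral_add (integrable_sign_mul hki x₀) hJD,
      integral_add (hJi.const_mul _) (hD.const_mul _), integral_const_mul, integral_const_mul,
      H.integral_sign_mul hv hkc hki] at e1
    have e2 := H.integral_speed_div_sq_le hC0 hC hm (hmle x₀) hx₀1
    have e3 : 1 / (2 * m ^ 2) * D ≤ 4 * C / m := by
      have : D ≤ 8 * C * m := by linarith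
      calc 1 / (2 * m ^ 2) * D ≤ 1 / (2 * m ^ 2) * (8 * C * m) := by gcongr
        _ = 4 * C / m := by field_simp; ring
    have e4 : 12 * C / m = 12 * (C / m) := by ring
    have e5 : 4 * C / m = 4 * (C / m) := by ring
    rw [← hJ, ← hDdef] at e1
    linarith
  rw [ha.momentum_eq, abs_mul, abs_of_pos (by norm_num : (0 : ℝ) < 1 / 2)]
  -- Young's inequality with weight `m` balances `W` against `J`.
  have hb : ‖∫ x, angular v (weakDeriv v) x * ((1 - ‖v x‖ ^ 2) / ‖v x‖)‖ ≤
      ∫ x, (√lam)⁻¹ * (1 / (2 * m) * angular v (weakDeriv v) x ^ 2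
        + m / 2 * (speed f ‖v x‖ / ‖v x‖) ^ 2) := by
    refine norm_integral_le_of_norm_le (((h3.const_mul _).add (hJi.const_mul _)).const_mul _)
      (Eventually.of_forall fun x => ?_)
    refine (H.abs_integrand_le _ (hpos x)).trans (mul_le_mul_of_nonneg_left ?_ hl.le)
    rw [← sq_abs (angular v (weakDeriv v) x)]
    set b := |angular v (weakDeriv v) x|
    set j := speed f ‖v x‖ / ‖v x‖
    have : 1 / (2 * m) * b ^ 2 + m / 2 * j ^ 2 - b * j = (b - m * j) ^ 2 / (2 * m) := by
      field_simp; ring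
    have h0 : 0 ≤ (b - m * j) ^ 2 / (2 * m) := by positivity
    linarith
  rw [integral_const_mul, integral_add (h3.const_mul _) (hJi.const_mul _), integral_const_mul,
    integral_const_mul, ← hWdef, ← hJ, Real.norm_eq_abs] at hb
  have e1 : 1 / (2 * m) * W ≤ 4 * C := by
    calc 1 / (2 * m) * W ≤ 1 / (2 * m) * (8 * C * m) := by gcongr; linarith
      _ = 4 * C := by field_simp; ring
  have e2 : m / 2 * J ≤ 6 * C := by
    calc m / 2 * J ≤ m / 2 * (12 * C / m) := by gcongr
      _ = 6 * C := by field_simp; ring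
  have e3 : (√lam)⁻¹ * (1 / (2 * m) * W + m / 2 * J) ≤ (√lam)⁻¹ * (10 * C) := by
    gcongr; linarith
  linarith

/-- Below the energy of the kink the momentum is bounded. -/
theorem exists_abs_momentum_le (H : Coercive f lam) :
    ∃ Q, ∀ v ∈ nonvanishingEnergySpace f, energy f v < kinkEnergy f → |momentum v| ≤ Q := by
  obtain ⟨C, hC0, hC⟩ := H.exists_speed_le
  refine ⟨max ((√lam)⁻¹ * kinkEnergy f) ((√lam)⁻¹ * (5 * C)), fun v hv hE => ?_⟩
  by_cases hhalf : ∃ x, ‖v x‖ < 1 / 2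
  · exact le_max_of_le_right (H.abs_momentum_le_of_lt_half hC0 hC hv hE hhalf)
  · push Not at hhalf
    refine le_max_of_le_left ((H.abs_momentum_le_of_half_le hv.1 hhalf).trans ?_)
    gcongr

end Coercive

end MomentumBound

/-! ### Changing the momentum by a phase -/

section PhaseTwist

variable {f : ℝ → ℝ} {lam : ℝ} {v : ℝ → ℂ}

/-- The weight `(1 - |v|²)/|v|` of the angular part in the momentum. -/
noncomputable def vacuumDefect (v : ℝ → ℂ) (x : ℝ) : ℝ := (1 - ‖v x‖ ^ 2) / ‖v x‖

theorem norm_pos_of_mem (hv : v ∈ nonvanishingEnergySpace f) (x : ℝ) : 0 < ‖v x‖ :=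
  hv.2.trans_le (ciInf_le (bddBelow_range_norm v) x)

theorem continuous_of_mem (hv : v ∈ energySpace f) : Continuous v := hv.1.1

theorem Coercive.memLp_vacuumDefect (H : Coercive f lam) (hv : v ∈ nonvanishingEnergySpace f) :
    MemLp (vacuumDefect v) 2 volume := by
  have hc := (continuous_of_mem hv.1).norm
  have hm := hv.2
  set m := ⨅ x, ‖v x‖ with hmdef
  refine memLp_of_sq_le (ψ := fun x => (lam * m ^ 2)⁻¹ * potential f (‖v x‖ ^ 2)) ?_
    (hv.1.2.2.const_mul _) (Eventually.of_forall fun x => ?_)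
  · exact ((continuous_const.sub (hc.pow 2)).div hc
      fun x => (norm_pos_of_mem hv x).ne').aestronglyMeasurable
  · have hmx : m ≤ ‖v x‖ := ciInf_le (bddBelow_range_norm v) x
    have hp := norm_pos_of_mem hv x
    have hl := H.pos
    rw [vacuumDefect, div_pow, div_le_iff₀ (by positivity), inv_mul_eq_div, div_mul_eq_mul_div,
      le_div_iff₀ (by positivity)]
    have h1 := H.le_potential _ (sq_nonneg ‖v x‖)
    have h2 : m ^ 2 ≤ ‖v x‖ ^ 2 := pow_le_pow_left₀ hm.le hmx 2
    calc (1 - ‖v x‖ ^ 2) ^ 2 * (lam * m ^ 2) = lam * (1 - ‖v x‖ ^ 2) ^ 2 * m ^ 2 := by ring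
      _ ≤ _ := mul_le_mul h1 h2 (sq_nonneg _) (H.potential_sq_nonneg _)

theorem IsAntideriv.mul_of_hasDerivAt {u g ψ ψ' : ℝ → ℂ} (h : IsAntideriv u g)
    (hψ : ∀ x, HasDerivAt ψ (ψ' x) x) (hψ' : Continuous ψ') :
    IsAntideriv (fun x => u x * ψ x) (fun x => u x * ψ' x + g x * ψ x) := by
  have hψc : Continuous ψ := continuous_iff_continuousAt.2 fun x => (hψ x).continuousAt
  have hψ1 : ContDiff ℝ 1 ψ := by
    rw [contDiff_one_iff_deriv]
    exact ⟨fun x => (hψ x).differentiableAt, by rwa [funext fun x => (hψ x).deriv]⟩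
  refine LocAbsCont.isAntideriv
    (fun a b => (h.locAbsCont a b).smul (locAbsCont_of_contDiff hψ1 a b)) ?_ ?_
  · exact (h.locAbsCont.continuous.mul hψ').locallyIntegrable.add
      (h.locallyIntegrable.mul_continuous hψc)
  · filter_upwards [h.ae_hasDerivAt] with x hx
    rw [add_comm]
    exact hx.mul (hψ x)

theorem momentum_eq_integral (hv : v ∈ energySpace f) :
    momentum v = 1 / 2 * ∫ x, angular v (weakDeriv v) x * vacuumDefect v x :=
  (isAntideriv_of_mem_energySpace hv).momentum_eq

/-- Twisting the phase of `v` by the optimal amount changes the momentum linearly and the energy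
quadratically. -/
theorem Coercive.exists_phase_twist (H : Coercive f lam) (hv : v ∈ nonvanishingEnergySpace f)
    (a : ℝ) : ∃ u ∈ nonvanishingEnergySpace f,
      momentum u = momentum v + a / 2 * (∫ x, vacuumDefect v x ^ 2) ∧
      energy f u = energy f v + 2 * a * momentum v + a ^ 2 / 2 * ∫ x, vacuumDefect v x ^ 2 := by
  have hc := continuous_of_mem hv.1
  have ha := isAntideriv_of_mem_energySpace hv.1
  have hpos := norm_pos_of_mem hv
  have hj := H.memLp_vacuumDefect hv
  have hw := memLp_angular hv.1
  have hg := integrable_norm_sq_of_mem hv.1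
  have hmo := momentum_eq_integral hv.1
  have hwj : Integrable fun x => angular v (weakDeriv v) x * vacuumDefect v x :=
    hw.integrable_mul hj
  have hjj : Integrable fun x => vacuumDefect v x ^ 2 := hj.integrable_sq
  set g := weakDeriv v with hgdef
  -- This phase speed adds to the angular part a multiple of the very weight against which the
  -- momentum integrates it.
  set ϑ : ℝ → ℝ := fun x => (1 - ‖v x‖ ^ 2) / ‖v x‖ ^ 2 with hϑ
  have hϑc : Continuous ϑ := (continuous_const.sub (hc.norm.pow 2)).div (hc.norm.pow 2)
    fun x => pow_ne_zero 2 (hpos x).ne'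
  set θ : ℝ → ℝ := fun x => ∫ t in (0 : ℝ)..x, ϑ t with hθ
  have hθd : ∀ x, HasDerivAt θ (ϑ x) x := fun x =>
    (hϑc.integral_hasStrictDerivAt 0 x).hasDerivAt
  have hθc : Continuous θ := continuous_iff_continuousAt.2 fun x => (hθd x).continuousAt
  set ψ : ℝ → ℂ := fun x => Complex.exp ((a * θ x : ℝ) * Complex.I) with hψ
  have hψn : ∀ x, ‖ψ x‖ = 1 := fun x => Complex.norm_exp_ofReal_mul_I _
  have hψd : ∀ x, HasDerivAt ψ (ψ x * ((a * ϑ x : ℝ) * Complex.I)) x := fun x =>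
    ((((hθd x).const_mul a).ofReal_comp).mul_const Complex.I).cexp
  have hψc : Continuous ψ := continuous_iff_continuousAt.2 fun x => (hψd x).continuousAt
  have hu := ha.mul_of_hasDerivAt hψd (hψc.mul ((Complex.continuous_ofReal.comp
    (continuous_const.mul hϑc)).mul continuous_const))
  set u : ℝ → ℂ := fun x => v x * ψ x with hudef
  set gu : ℝ → ℂ := fun x => v x * (ψ x * ((a * ϑ x : ℝ) * Complex.I)) + g x * ψ x with hgu
  have hun : ∀ x, ‖u x‖ = ‖v x‖ := fun x => by simp [hudef, hψn]
  have hψ1 : ∀ x, (ψ x).re ^ 2 + (ψ x).im ^ 2 = 1 := fun x => by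
    rw [← norm_sq_eq, hψn, one_pow]
  have hϑj : ∀ x, ϑ x * ‖v x‖ = vacuumDefect v x := fun x => by
    have := (hpos x).ne'
    simp only [hϑ, vacuumDefect]; field_simp
  have hang : ∀ x, (v x).re * (g x).im - (v x).im * (g x).re = angular v g x * ‖v x‖ := fun x => by
    rw [angular, div_mul_cancel₀ _ (hpos x).ne']
  have hang' : ∀ x, angular u gu x = angular v g x + a * vacuumDefect v x := fun x => by
    have e : (u x).re * (gu x).im - (u x).im * (gu x).re =
        (angular v g x + a * vacuumDefect v x) * ‖v x‖ := by
      rw [add_mul, ← hang, ← hϑj]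
      have h1 := hψ1 x
      have h2 := norm_sq_eq (v x)
      simp only [hudef, hgu, Complex.add_re, Complex.add_im, Complex.mul_re, Complex.mul_im,
        Complex.ofReal_re, Complex.ofReal_im, Complex.I_re, Complex.I_im]
      linear_combination ((v x).re * (g x).im - (v x).im * (g x).re +
        a * ϑ x * ((v x).re ^ 2 + (v x).im ^ 2)) * h1 - a * ϑ x * h2
    rw [angular, e, hun, mul_div_cancel_right₀ _ (hpos x).ne']
  have hnorm : ∀ x, ‖gu x‖ ^ 2 = ‖g x‖ ^ 2 + (2 * a * (angular v g x * vacuumDefect v x)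
      + a ^ 2 * vacuumDefect v x ^ 2) := fun x => by
    have e : gu x = (g x + v x * ((a * ϑ x : ℝ) * Complex.I)) * ψ x := by
      simp only [hgu]; ring
    rw [e, norm_mul, hψn, mul_one, norm_sq_eq, norm_sq_eq, ← hϑj]
    have h2 := norm_sq_eq (v x)
    simp only [Complex.add_re, Complex.add_im, Complex.mul_re, Complex.mul_im,
      Complex.ofReal_re, Complex.ofReal_im, Complex.I_re, Complex.I_im]
    linear_combination (2 * a * ϑ x) * hang x - a ^ 2 * ϑ x ^ 2 * h2
  have hi2 : Integrable fun x => 2 * a * (angular v g x * vacuumDefect v x)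
      + a ^ 2 * vacuumDefect v x ^ 2 := (hwj.const_mul _).add (hjj.const_mul _)
  have hi : Integrable fun x => ‖gu x‖ ^ 2 := by
    simp_rw [hnorm]
    exact hg.add hi2
  have hmem : u ∈ energySpace f := by
    refine hu.mem_energySpace ((memLp_two_iff_integrable_sq_norm
      hu.locallyIntegrable.aestronglyMeasurable).2 hi) ?_
    simp_rw [hun]
    exact hv.1.2.2
  refine ⟨u, ⟨hmem, ?_⟩, ?_, ?_⟩
  · simp_rw [hun]; exact hv.2
  · rw [hu.momentum_eq, hmo]
    have e : ∀ x, angular u gu x * ((1 - ‖u x‖ ^ 2) / ‖u x‖) =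
        angular v g x * vacuumDefect v x + a * vacuumDefect v x ^ 2 := fun x => by
      rw [hang', hun, ← vacuumDefect]; ring
    simp_rw [e]
    rw [integral_add hwj (hjj.const_mul _), integral_const_mul]
    ring
  · rw [hu.energy_eq, hmo]
    simp_rw [hnorm, hun]
    rw [integral_add hg hi2, integral_add (hwj.const_mul _) (hjj.const_mul _),
      integral_const_mul, integral_const_mul, energy]
    ring

theorem Coercive.integral_vacuumDefect_pos (H : Coercive f lam)
    (hv : v ∈ nonvanishingEnergySpace f) (hp : momentum v ≠ 0) :
    0 < ∫ x, vacuumDefect v x ^ 2 := by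
  refine lt_of_le_of_ne (integral_nonneg fun _ => sq_nonneg _) fun h0 => hp ?_
  have h1 := (integral_eq_zero_iff_of_nonneg (fun _ => sq_nonneg _)
    (H.memLp_vacuumDefect hv).integrable_sq).1 h0.symm
  rw [momentum_eq_integral hv.1, integral_eq_zero_of_ae, mul_zero]
  filter_upwards [h1] with x hx
  have : vacuumDefect v x = 0 := by simpa using hx
  simp [this]

/-- A positive real profile with a twisted phase. -/
theorem Coercive.exists_twisted_profile (H : Coercive f lam) {ρ ρ' : ℝ → ℝ} {c : ℝ} (hc : 0 < c)
    (hρ : ∀ x, c ≤ ρ x) (hd : ∀ x, HasDerivAt ρ (ρ' x) x) (hρc : Continuous ρ')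
    (hρ' : Integrable fun x => ρ' x ^ 2) (hF : Integrable fun x => potential f (ρ x ^ 2)) :
    Integrable (fun x => ((1 - ρ x ^ 2) / ρ x) ^ 2) ∧ ∀ a : ℝ,
    ∃ u ∈ nonvanishingEnergySpace f,
      momentum u = a / 2 * (∫ x, ((1 - ρ x ^ 2) / ρ x) ^ 2) ∧
      energy f u = 1 / 2 * (∫ x, ρ' x ^ 2) + 1 / 2 * (∫ x, potential f (ρ x ^ 2))
        + a ^ 2 / 2 * ∫ x, ((1 - ρ x ^ 2) / ρ x) ^ 2 := by
  set v : ℝ → ℂ := fun x => (ρ x : ℂ) with hvdef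
  set g : ℝ → ℂ := fun x => (ρ' x : ℂ) with hg
  have hvn : ∀ x, ‖v x‖ = ρ x := fun x => by
    rw [hvdef, Complex.norm_real, Real.norm_of_nonneg (hc.le.trans (hρ x))]
  have hgn : ∀ x, ‖g x‖ ^ 2 = ρ' x ^ 2 := fun x => by
    rw [hg, Complex.norm_real, Real.norm_eq_abs, sq_abs]
  have hvd : ∀ x, HasDerivAt v (g x) x := fun x => (hd x).ofReal_comp
  have hgc : Continuous g := Complex.continuous_ofReal.comp hρc
  have ha : IsAntideriv v g := by
    have h1 : ContDiff ℝ 1 v := by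
      rw [contDiff_one_iff_deriv]
      exact ⟨fun x => (hvd x).differentiableAt, by rwa [funext fun x => (hvd x).deriv]⟩
    have := isAntideriv_of_contDiff h1
    rwa [funext fun x => (hvd x).deriv] at this
  have hmem : v ∈ nonvanishingEnergySpace f := by
    refine ⟨ha.mem_energySpace ((memLp_two_iff_integrable_sq_norm
      hgc.aestronglyMeasurable).2 (by simpa only [hgn])) (by simpa only [hvn]), ?_⟩
    simp only [hvn]
    exact hc.trans_le (le_ciInf hρ)
  have hp : momentum v = 0 := by
    rw [ha.momentum_eq]
    simp [angular, hvdef, hg]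
  have hi := (H.memLp_vacuumDefect hmem).integrable_sq
  simp only [vacuumDefect, hvn] at hi
  refine ⟨hi, fun a => ?_⟩
  obtain ⟨u, hu, h1, h2⟩ := H.exists_phase_twist hmem a
  simp only [vacuumDefect, hvn] at h1 h2
  rw [hp, zero_add] at h1
  rw [hp, mul_zero, add_zero, ha.energy_eq] at h2
  simp only [hvn, hgn] at h2
  exact ⟨u, hu, h1, h2⟩

end PhaseTwist

/-! ### Construction and energy of the kink -/

section Profile

variable {f : ℝ → ℝ} {lam : ℝ}

namespace Coercive

/-- The potential is nonnegative near 1 and vanishes there, so its derivative `-f 1` is zero. -/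
theorem apply_one (H : Coercive f lam) : f 1 = 0 := by
  have hmin : IsLocalMin (potential f) 1 := by
    filter_upwards [eventually_ge_nhds (show (0 : ℝ) < 1 by norm_num)] with ρ hρ
    rw [potential_one]
    exact (mul_nonneg H.pos.le (sq_nonneg _)).trans (H.le_potential ρ hρ)
  have := hmin.hasDerivAt_eq_zero (hasDerivAt_potential H.continuous 1)
  linarith

/-- `f` vanishes at 1 and is Lipschitz on `[0, 1]`, so its integral is quadratically small. This
upper bound makes the kink take infinite time to reach ±1. -/
theorem exists_potential_le (H : Coercive f lam) :
    ∃ L, 0 < L ∧ ∀ ρ ∈ Icc (0 : ℝ) 1, potential f ρ ≤ L * (1 - ρ) ^ 2 := by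
  have hd : Continuous (deriv f) := H.contDiff.continuous_deriv (by norm_num)
  obtain ⟨L, hL⟩ := (isCompact_Icc (a := (0 : ℝ)) (b := 1)).exists_bound_of_continuousOn
    hd.continuousOn
  have hL0 : 0 ≤ L := (norm_nonneg _).trans (hL 0 (by simp))
  refine ⟨L + 1, by linarith, fun ρ hρ => ?_⟩
  have h1 : ∀ r ∈ Icc (0 : ℝ) 1, ‖f r‖ ≤ L * (1 - r) := fun r hr => by
    have := (convex_Icc (0 : ℝ) 1).norm_image_sub_le_of_norm_hasDerivWithin_le
      (fun s _ => (H.contDiff.differentiable (by norm_num) s).hasDerivAt.hasDerivWithinAt) hL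
      (right_mem_Icc.2 zero_le_one) hr
    rw [H.apply_one, sub_zero, Real.norm_eq_abs (r - 1), abs_sub_comm,
      abs_of_nonneg (by linarith [hr.2])] at this
    exact this
  have h2 := intervalIntegral.norm_integral_le_of_norm_le_const (a := ρ) (b := 1) (f := f)
    (C := L * (1 - ρ)) fun r hr => by
      rw [uIoc_of_le hρ.2] at hr
      refine (h1 r ⟨hρ.1.trans hr.1.le, hr.2⟩).trans ?_
      gcongr
      exact hr.1.le
  rw [abs_of_nonneg (by linarith [hρ.2])] at h2
  have h3 := (le_abs_self _).trans h2
  have h4 : potential f ρ = ∫ r in ρ..1, f r := rfl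
  rw [h4]
  nlinarith [sq_nonneg (1 - ρ)]

theorem exists_speed_le_mul (H : Coercive f lam) :
    ∃ C, 0 < C ∧ ∀ s ∈ Ioo (-1 : ℝ) 1, speed f s ≤ C * (1 - s ^ 2) := by
  obtain ⟨L, hL, hF⟩ := H.exists_potential_le
  refine ⟨√L, Real.sqrt_pos.2 hL, fun s hs => ?_⟩
  have hs2 : s ^ 2 ≤ 1 := by nlinarith [hs.1, hs.2]
  rw [← Real.sqrt_sq (sub_nonneg.2 hs2), ← Real.sqrt_mul hL.le]
  exact Real.sqrt_le_sqrt (hF _ ⟨sq_nonneg s, hs2⟩)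

end Coercive

theorem hasDerivAt_tanh (y : ℝ) : HasDerivAt Real.tanh (1 - Real.tanh y ^ 2) y := by
  have h := (Real.hasDerivAt_sinh y).div (Real.hasDerivAt_cosh y) (Real.cosh_pos y).ne'
  have e : Real.tanh = fun y => Real.sinh y / Real.cosh y :=
    funext fun y => Real.tanh_eq_sinh_div_cosh y
  rw [e]
  convert! h using 1
  have := (Real.cosh_pos y).ne'
  field_simp

/-- The increasing real kink profile centred at the origin. -/
structure IsProfile (f w : ℝ → ℝ) : Prop where
  zero : w 0 = 0
  mem : ∀ x, w x ∈ Ioo (-1 : ℝ) 1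
  hasDerivAt : ∀ x, HasDerivAt w (speed f (w x)) x
  tendsto_atTop : Tendsto w atTop (𝓝 1)
  tendsto_atBot : Tendsto w atBot (𝓝 (-1))

/-- Separation of variables for w' = `speed f` w: with w = tanh y it reads dx = φ(y) dy. Since `φ ≥
C⁻¹`, its primitive `Φ` is an increasing bijection of the line, and w is tanh composed with its
inverse. -/
theorem Coercive.exists_isProfile (H : Coercive f lam) : ∃ w, IsProfile f w := by
  obtain ⟨C, hC, hsp⟩ := H.exists_speed_le_mul
  have hmem : ∀ y, Real.tanh y ∈ Ioo (-1 : ℝ) 1 := fun y => Real.tanh_bijOn.mapsTo (mem_univ y)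
  have hlt : ∀ y, Real.tanh y ^ 2 < 1 := fun y => by nlinarith [(hmem y).1, (hmem y).2]
  have hspos : ∀ y, 0 < speed f (Real.tanh y) := fun y => H.speed_pos (hlt y).ne
  have htc : Continuous Real.tanh :=
    continuous_iff_continuousAt.2 fun y => (hasDerivAt_tanh y).continuousAt
  set φ : ℝ → ℝ := fun y => (1 - Real.tanh y ^ 2) / speed f (Real.tanh y) with hφ
  have hφc : Continuous φ := (continuous_const.sub (htc.pow 2)).div
    ((continuous_speed H.continuous).comp htc) fun y => (hspos y).ne'
  have hφle : ∀ y, C⁻¹ ≤ φ y := fun y => by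
    rw [hφ, le_div_iff₀ (hspos y), inv_mul_le_iff₀ hC]
    exact hsp _ (hmem y)
  have hφpos : ∀ y, 0 < φ y := fun y => (inv_pos.2 hC).trans_le (hφle y)
  set Φ : ℝ → ℝ := fun y => ∫ t in (0 : ℝ)..y, φ t with hΦ
  have hΦd : ∀ y, HasDerivAt Φ (φ y) y := fun y => (hφc.integral_hasStrictDerivAt 0 y).hasDerivAt
  have hΦc : Continuous Φ := continuous_iff_continuousAt.2 fun y => (hΦd y).continuousAt
  have hmono : StrictMono Φ := strictMono_of_deriv_pos fun y => by
    rw [(hΦd y).deriv]; exact hφpos y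
  have hΦ0 : Φ 0 = 0 := by simp [hΦ]
  have hm : Monotone fun y => Φ y - C⁻¹ * y :=
    monotone_of_hasDerivAt_nonneg
      (fun y => (hΦd y).sub ((hasDerivAt_id y).const_mul C⁻¹))
      (fun y => by simpa using hφle y)
  have hsurj : Function.Surjective Φ := by
    refine hΦc.surjective ?_ ?_
    · refine tendsto_atTop_mono' _ ?_ (tendsto_id.const_mul_atTop (inv_pos.2 hC))
      filter_upwards [eventually_ge_atTop 0] with y hy
      have := hm hy
      simp only [hΦ0] at this
      simp only [id]
      linarith
    · refine tendsto_atBot_mono' _ ?_ (tendsto_id.const_mul_atBot (inv_pos.2 hC))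
      filter_upwards [eventually_le_atBot 0] with y hy
      have := hm hy
      simp only [hΦ0] at this
      simp only [id]
      linarith
  set e := hmono.orderIsoOfSurjective Φ hsurj with he
  have hΦe : ∀ x, Φ (e.symm x) = x := fun x => e.apply_symm_apply x
  have hed : ∀ x, HasDerivAt e.symm (φ (e.symm x))⁻¹ x := fun x =>
    HasDerivAt.of_local_left_inverse e.symm.continuous.continuousAt (hΦd _) (hφpos _).ne'
      (Eventually.of_forall hΦe)
  have htanh : StrictMono Real.tanh := strictMono_of_deriv_pos fun y => by
    rw [(hasDerivAt_tanh y).deriv]; linarith [hlt y]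
  have hwm : StrictMono fun x => Real.tanh (e.symm x) := htanh.comp e.symm.strictMono
  have hrange : range (fun x => Real.tanh (e.symm x)) = Ioo (-1 : ℝ) 1 := by
    rw [show (fun x => Real.tanh (e.symm x)) = Real.tanh ∘ e.symm from rfl,
      e.symm.surjective.range_comp, ← image_univ, Real.tanh_bijOn.image_eq]
  refine ⟨fun x => Real.tanh (e.symm x), ?_, fun x => hmem _, fun x => ?_, ?_, ?_⟩
  · have : e.symm 0 = 0 := by
      apply hmono.injective
      rw [hΦe, hΦ0]
    simp [this]
  · have := (hasDerivAt_tanh (e.symm x)).comp x (hed x)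
    convert! this using 1
    have h1 := (hspos (e.symm x)).ne'
    have h2 : 1 - Real.tanh (e.symm x) ^ 2 ≠ 0 := by linarith [hlt (e.symm x)]
    simp only [hφ]
    field_simp
  · refine tendsto_atTop_isLUB hwm.monotone ?_
    rw [hrange]; exact isLUB_Ioo (by norm_num)
  · refine tendsto_atBot_isGLB hwm.monotone ?_
    rw [hrange]; exact isGLB_Ioo (by norm_num)

namespace IsProfile

variable {w : ℝ → ℝ}

theorem sq_lt_one (hw : IsProfile f w) (x : ℝ) : w x ^ 2 < 1 := by
  nlinarith [(hw.mem x).1, (hw.mem x).2]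

theorem continuous (hw : IsProfile f w) : Continuous w :=
  continuous_iff_continuousAt.2 fun x => (hw.hasDerivAt x).continuousAt

/-- The potential is positive along the profile, so the root is differentiable, and w' cancels the
root in the denominator. This is the second-order equation. -/
theorem hasDerivAt_speed (hw : IsProfile f w) (H : Coercive f lam) (x : ℝ) :
    HasDerivAt (fun x => speed f (w x)) (-(w x * f (w x ^ 2))) x := by
  have hp := H.speed_pos (hw.sq_lt_one x).ne
  have hF : potential f (w x ^ 2) ≠ 0 := by
    rw [← H.speed_sq]; positivity
  have h1 := (hasDerivAt_potential H.continuous (w x ^ 2)).comp x ((hw.hasDerivAt x).pow 2)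
  have h2 := h1.sqrt hF
  convert! h2 using 1
  have e : √((potential f ∘ (w ^ 2)) x) = speed f (w x) := rfl
  rw [e]
  field_simp
  norm_num
  ring

theorem sub_eq_integral (hw : IsProfile f w) (H : Coercive f lam) (a b : ℝ) :
    ∫ x in a..b, speed f (w x) ^ 2 = ∫ s in (w a)..(w b), speed f s := by
  have := intervalIntegral.integral_comp_mul_deriv (a := a) (b := b) (f := w)
    (f' := fun x => speed f (w x)) (g := speed f) (fun x _ => hw.hasDerivAt x)
    ((continuous_speed H.continuous).comp hw.continuous).continuousOn
    (continuous_speed H.continuous)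
  rw [← this]
  congr 1
  ext x
  simp [sq]

theorem integral_speed_eq_kinkEnergy (hf : Continuous f) :
    ∫ s in (-1 : ℝ)..1, speed f s = kinkEnergy f := by
  have hc := continuous_speed hf
  rw [kinkEnergy, ← intervalIntegral.integral_add_adjacent_intervals (b := 0)
    (hc.intervalIntegrable _ _) (hc.intervalIntegrable _ _), two_mul]
  congr 1
  have := intervalIntegral.integral_comp_neg (a := 0) (b := 1) (speed f)
  rw [neg_zero] at this
  rw [← this]
  simp [speed]

/-- Substituting s = w x gives the integral of the speed between `w (-R)` and `w R`, which tend to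
-1 and 1. -/
theorem tendsto_integral (hw : IsProfile f w) (H : Coercive f lam) :
    Tendsto (fun R => ∫ x in (-R)..R, speed f (w x) ^ 2) atTop (𝓝 (kinkEnergy f)) := by
  have hc := continuous_speed H.continuous
  simp_rw [hw.sub_eq_integral H]
  rw [← integral_speed_eq_kinkEnergy H.continuous]
  have hK : Continuous fun s => ∫ t in (0 : ℝ)..s, speed f t :=
    intervalIntegral.continuous_primitive (fun a b => hc.intervalIntegrable a b) 0
  have e : ∀ a b, ∫ s in a..b, speed f s =
      (∫ s in (0 : ℝ)..b, speed f s) - ∫ s in (0 : ℝ)..a, speed f s := fun a b =>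
    (intervalIntegral.integral_interval_sub_left (hc.intervalIntegrable _ _)
      (hc.intervalIntegrable _ _)).symm
  simp_rw [e (w _), e (-1)]
  exact ((hK.tendsto 1).comp hw.tendsto_atTop).sub
    ((hK.tendsto (-1)).comp (hw.tendsto_atBot.comp tendsto_neg_atTop_atBot))

theorem integrable_speed_sq (hw : IsProfile f w) (H : Coercive f lam) :
    Integrable fun x => speed f (w x) ^ 2 := by
  have hc : Continuous fun x => speed f (w x) ^ 2 :=
    ((continuous_speed H.continuous).comp hw.continuous).pow 2
  refine integrable_of_intervalIntegral_norm_tendsto (l := atTop) (a := fun R : ℝ => -R)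
    (b := fun R => R) (kinkEnergy f) (fun R => ?_) tendsto_neg_atTop_atBot tendsto_id ?_
  · exact (hc.continuousOn.integrableOn_Icc).mono_set Ioc_subset_Icc_self
  · simp_rw [Real.norm_of_nonneg (sq_nonneg _)]
    exact hw.tendsto_integral H

theorem integral_speed_sq (hw : IsProfile f w) (H : Coercive f lam) :
    ∫ x, speed f (w x) ^ 2 = kinkEnergy f :=
  tendsto_nhds_unique (intervalIntegral_tendsto_integral (hw.integrable_speed_sq H)
    tendsto_neg_atTop_atBot tendsto_id) (hw.tendsto_integral H)

/-- The derivatives of a translated and rotated kink. -/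
theorem hasDerivAt_rotate (hw : IsProfile f w) (α : ℂ) (x₀ x : ℝ) :
    HasDerivAt (fun x => α * (w (x - x₀) : ℂ)) (α * (speed f (w (x - x₀)) : ℂ)) x :=
  (((hw.hasDerivAt (x - x₀)).comp_sub_const x x₀).ofReal_comp).const_mul α

theorem hasDerivAt_rotate_speed (hw : IsProfile f w) (H : Coercive f lam) (α : ℂ) (x₀ x : ℝ) :
    HasDerivAt (fun x => α * (speed f (w (x - x₀)) : ℂ))
      (α * ((-(w (x - x₀) * f (w (x - x₀) ^ 2)) : ℝ) : ℂ)) x :=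
  ((((hw.hasDerivAt_speed H (x - x₀)).comp_sub_const x x₀)).ofReal_comp).const_mul α

theorem contDiff_rotate (hw : IsProfile f w) (H : Coercive f lam) (α : ℂ) (x₀ : ℝ) :
    ContDiff ℝ 2 fun x => α * (w (x - x₀) : ℂ) := by
  rw [show (2 : WithTop ℕ∞) = 1 + 1 by norm_num, contDiff_succ_iff_deriv,
    funext fun x => (hw.hasDerivAt_rotate α x₀ x).deriv, contDiff_one_iff_deriv,
    funext fun x => (hw.hasDerivAt_rotate_speed H α x₀ x).deriv]
  have hc : Continuous fun x => w (x - x₀) := hw.continuous.comp (continuous_id.sub continuous_const)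
  refine ⟨fun x => (hw.hasDerivAt_rotate α x₀ x).differentiableAt, by simp,
    fun x => (hw.hasDerivAt_rotate_speed H α x₀ x).differentiableAt, ?_⟩
  exact continuous_const.mul (Complex.continuous_ofReal.comp
    (hc.mul (H.continuous.comp (hc.pow 2))).neg)

theorem isKink (hw : IsProfile f w) (H : Coercive f lam) : IsKink f fun x => (w x : ℂ) := by
  have e : (fun x => (w x : ℂ)) = fun x => (1 : ℂ) * (w (x - 0) : ℂ) := by
    ext x; simp
  have hn : ∀ x, ‖(w x : ℂ)‖ = |w x| := fun x => by rw [Complex.norm_real, Real.norm_eq_abs]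
  have h1 := hw.hasDerivAt_rotate 1 0
  have h2 := hw.hasDerivAt_rotate_speed H 1 0
  refine ⟨⟨e ▸ hw.contDiff_rotate H 1 0, fun x => ?_⟩, ?_, ?_, ?_⟩
  · rw [e, funext fun x => (h1 x).deriv, (h2 x).deriv]
    simp only [one_mul, sub_zero, hn, sq_abs]
    push_cast
    ring
  · rintro ⟨z, hz⟩
    have h3 : ∀ x, w x = 0 := fun x => by
      have h4 : (w x : ℂ) = (w 0 : ℂ) := by rw [hz, hz]
      rw [Complex.ofReal_inj.1 h4, hw.zero]
    have := hw.tendsto_atTop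
    rw [funext h3] at this
    exact zero_ne_one (tendsto_nhds_unique tendsto_const_nhds this)
  · simp_rw [hn]
    simpa using hw.tendsto_atTop.abs
  · simp_rw [hn]
    simpa using hw.tendsto_atBot.abs

theorem rotate_mem_energySpace (hw : IsProfile f w) (H : Coercive f lam) {α : ℂ} (hα : ‖α‖ = 1)
    (x₀ : ℝ) : (fun x => α * (w (x - x₀) : ℂ)) ∈ energySpace f ∧
      energy f (fun x => α * (w (x - x₀) : ℂ)) = kinkEnergy f := by
  have ha := isAntideriv_of_contDiff ((hw.contDiff_rotate H α x₀).of_le (by norm_num))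
  rw [funext fun x => (hw.hasDerivAt_rotate α x₀ x).deriv] at ha
  have h1 : ∀ x, ‖α * (w (x - x₀) : ℂ)‖ ^ 2 = w (x - x₀) ^ 2 := fun x => by
    rw [norm_mul, hα, one_mul, Complex.norm_real, Real.norm_eq_abs, sq_abs]
  have h2 : ∀ x, ‖α * (speed f (w (x - x₀)) : ℂ)‖ ^ 2 = speed f (w (x - x₀)) ^ 2 := fun x => by
    rw [norm_mul, hα, one_mul, Complex.norm_real, Real.norm_eq_abs, sq_abs]
  have hi := (hw.integrable_speed_sq H).comp_sub_right x₀
  have hI : ∫ x, speed f (w (x - x₀)) ^ 2 = kinkEnergy f := by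
    rw [integral_sub_right_eq_self (fun x => speed f (w x) ^ 2), hw.integral_speed_sq H]
  constructor
  · refine ha.mem_energySpace ((memLp_two_iff_integrable_sq_norm
      ha.locallyIntegrable.aestronglyMeasurable).2 ?_) ?_
    · simpa only [h2]
    · simpa only [h1, ← H.speed_sq]
  -- Equipartition: kinetic and potential densities both equal the squared speed.
  · rw [ha.energy_eq]
    simp only [h1, h2, ← H.speed_sq, hI]
    ring

end IsProfile

end Profile

/-! ### Classification of black solitons -/

section Uniqueness

variable {f : ℝ → ℝ} {lam : ℝ}

/-- On a bounded interval both solutions stay in a closed ball, compact by properness, where `V` is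
Lipschitz; no global Lipschitz bound is needed. -/
theorem eq_of_hasDerivAt_of_contDiff {E : Type*} [NormedAddCommGroup E] [NormedSpace ℝ E]
    [ProperSpace E] {V : E → E} (hV : ContDiff ℝ 1 V) {y z : ℝ → E}
    (hy : ∀ t, HasDerivAt y (V (y t)) t) (hz : ∀ t, HasDerivAt z (V (z t)) t) {t₀ : ℝ}
    (h0 : y t₀ = z t₀) : y = z := by
  have hyc : Continuous y := continuous_iff_continuousAt.2 fun t => (hy t).continuousAt
  have hzc : Continuous z := continuous_iff_continuousAt.2 fun t => (hz t).continuousAt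
  ext t
  obtain ⟨a, b, ht, ht₀⟩ : ∃ a b, t ∈ Ioo a b ∧ t₀ ∈ Ioo a b := by
    use (min (-|t|) (-|t₀|) - 1), (max |t| |t₀| + 1)
    grind
  obtain ⟨R, hR⟩ := (isCompact_Icc (a := a) (b := b)).exists_bound_of_continuousOn
    hyc.continuousOn
  obtain ⟨R', hR'⟩ := (isCompact_Icc (a := a) (b := b)).exists_bound_of_continuousOn
    hzc.continuousOn
  obtain ⟨K, hK⟩ := LocallyLipschitzOn.exists_lipschitzOnWith_of_compact
    (isCompact_closedBall (0 : E) (max R R'))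
    (hV.locallyLipschitz.locallyLipschitzOn (s := Metric.closedBall (0 : E) (max R R')))
  refine ODE_solution_unique_of_mem_Ioo (v := fun _ => V) (K := K)
    (s := fun _ => Metric.closedBall (0 : E) (max R R')) (fun _ _ => hK) ht₀
    (fun s hs => ⟨hy s, ?_⟩) (fun s hs => ⟨hz s, ?_⟩) h0 ht
  · rw [mem_closedBall_zero_iff]
    exact (hR s (Ioo_subset_Icc_self hs)).trans (le_max_left _ _)
  · rw [mem_closedBall_zero_iff]
    exact (hR' s (Ioo_subset_Icc_self hs)).trans (le_max_right _ _)

/-- A function with the same limit at both ends attains a global extremum on the side of `l` where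
`η x₀` lies. -/
theorem exists_deriv_eq_zero_of_tendsto_cocompact {η η' : ℝ → ℝ} {l : ℝ}
    (hd : ∀ x, HasDerivAt η (η' x) x) (hlim : Tendsto η (cocompact ℝ) (𝓝 l)) {x₀ : ℝ}
    (hx₀ : η x₀ ≠ l) : ∃ x, η' x = 0 ∧ η x ≠ l := by
  have hc : Continuous η := continuous_iff_continuousAt.2 fun x => (hd x).continuousAt
  rcases lt_or_gt_of_ne hx₀ with h | h
  · obtain ⟨x, hx⟩ := hc.exists_forall_le' x₀ ((hlim.eventually_const_lt h).mono fun _ => le_of_lt)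
    exact ⟨x, (IsLocalMin.hasDerivAt_eq_zero (Eventually.of_forall hx) (hd x)),
      ((hx x₀).trans_lt h).ne⟩
  · obtain ⟨x, hx⟩ := hc.exists_forall_ge' x₀ ((hlim.eventually_lt_const h).mono fun _ => le_of_lt)
    exact ⟨x, (IsLocalMax.hasDerivAt_eq_zero (Eventually.of_forall hx) (hd x)),
      (h.trans_le (hx x₀)).ne'⟩

theorem nonpos_of_hasDerivAt_of_bounded {S S' : ℝ → ℝ} {c M : ℝ}
    (hd : ∀ x, HasDerivAt S (S' x) x) (hlim : Tendsto S' atTop (𝓝 c))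
    (hM : ∀ᶠ x in atTop, S x ≤ M) : c ≤ 0 := by
  by_contra hc
  rw [not_le] at hc
  obtain ⟨R, hR⟩ := eventually_atTop.1 (hlim.eventually_const_lt (half_lt_self hc))
  have hlin : ∀ x, R ≤ x → c / 2 * (x - R) + S R ≤ S x := fun x hx => by
    have := (convex_Ici R).mul_sub_le_image_sub_of_le_deriv
      (fun x _ => (hd x).continuousAt.continuousWithinAt)
      (fun x _ => (hd x).differentiableAt.differentiableWithinAt)
      (fun x hx => by rw [(hd x).deriv]; exact (hR x (interior_subset hx)).le)
      R self_mem_Ici x hx hx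
    linarith
  have ht : Tendsto (fun x => c / 2 * (x - R) + S R) atTop atTop :=
    tendsto_atTop_add_const_right _ _
      ((tendsto_atTop_add_const_right _ (-R) tendsto_id).const_mul_atTop (half_pos hc))
  obtain ⟨x, h1, h2, h3⟩ := (hM.and ((eventually_ge_atTop R).and
    (ht.eventually_gt_atTop M))).exists
  linarith [hlin x h2]

/-- The planar form of the stationary equation. -/
structure IsPlanarOrbit (f a b p q : ℝ → ℝ) : Prop where
  hasDerivAt_a : ∀ x, HasDerivAt a (p x) x
  hasDerivAt_b : ∀ x, HasDerivAt b (q x) x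
  hasDerivAt_p : ∀ x, HasDerivAt p (-(a x * f (a x ^ 2 + b x ^ 2))) x
  hasDerivAt_q : ∀ x, HasDerivAt q (-(b x * f (a x ^ 2 + b x ^ 2))) x
  tendsto : Tendsto (fun x => a x ^ 2 + b x ^ 2) (cocompact ℝ) (𝓝 1)

namespace IsPlanarOrbit

variable {a b p q : ℝ → ℝ}

theorem hasDerivAt_normSq (h : IsPlanarOrbit f a b p q) (x : ℝ) :
    HasDerivAt (fun x => a x ^ 2 + b x ^ 2) (2 * (a x * p x + b x * q x)) x := by
  have := ((h.hasDerivAt_a x).pow 2).add ((h.hasDerivAt_b x).pow 2)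
  convert! this using 1
  norm_num
  ring

/-- Conservation of the energy density, whose value is fixed at infinity. -/
theorem speed_sq_eq (h : IsPlanarOrbit f a b p q) (H : Coercive f lam) (x : ℝ) :
    p x ^ 2 + q x ^ 2 = potential f (a x ^ 2 + b x ^ 2) := by
  have hFc := continuous_potential H.continuous
  have hd : ∀ x, HasDerivAt (fun x => p x ^ 2 + q x ^ 2 - potential f (a x ^ 2 + b x ^ 2)) 0 x := by
    intro x
    have h1 := (((h.hasDerivAt_p x).pow 2).add ((h.hasDerivAt_q x).pow 2)).sub
      ((hasDerivAt_potential H.continuous (a x ^ 2 + b x ^ 2)).comp x (h.hasDerivAt_normSq x))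
    convert! h1 using 1
    norm_num
    ring
  have hconst : ∀ x y, p x ^ 2 + q x ^ 2 - potential f (a x ^ 2 + b x ^ 2) =
      p y ^ 2 + q y ^ 2 - potential f (a y ^ 2 + b y ^ 2) :=
    is_const_of_deriv_eq_zero (fun x => (hd x).differentiableAt) fun x => (hd x).deriv
  set c := p 0 ^ 2 + q 0 ^ 2 - potential f (a 0 ^ 2 + b 0 ^ 2) with hc
  have hcx : ∀ x, p x ^ 2 + q x ^ 2 = c + potential f (a x ^ 2 + b x ^ 2) := fun x => by
    linarith [hconst x 0]
  have hη : Tendsto (fun x => a x ^ 2 + b x ^ 2) atTop (𝓝 1) :=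
    h.tendsto.mono_left (by rw [cocompact_eq_atBot_atTop]; exact le_sup_right)
  have hFη : Tendsto (fun x => potential f (a x ^ 2 + b x ^ 2)) atTop (𝓝 0) := by
    have := (hFc.tendsto 1).comp hη
    rwa [potential_one] at this
  have hsp : Tendsto (fun x => c + potential f (a x ^ 2 + b x ^ 2)) atTop (𝓝 c) := by
    simpa using hFη.const_add c
  have hc0 : 0 ≤ c := ge_of_tendsto hsp (Eventually.of_forall fun x => by
    rw [← hcx]; positivity)
  -- Virial argument: this quantity is eventually bounded above while its derivative tends to `c`,
  -- because `f 1 = 0`. Hence `c ≤ 0`.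
  have hSd : ∀ x, HasDerivAt (fun x => a x * p x + b x * q x)
      (c + potential f (a x ^ 2 + b x ^ 2) -
        (a x ^ 2 + b x ^ 2) * f (a x ^ 2 + b x ^ 2)) x := fun x => by
    have h1 := ((h.hasDerivAt_a x).mul (h.hasDerivAt_p x)).add
      ((h.hasDerivAt_b x).mul (h.hasDerivAt_q x))
    convert! h1 using 1
    rw [← hcx]
    ring
  have hSlim : Tendsto (fun x => c + potential f (a x ^ 2 + b x ^ 2) -
      (a x ^ 2 + b x ^ 2) * f (a x ^ 2 + b x ^ 2)) atTop (𝓝 c) := by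
    have := hsp.sub (hη.mul ((H.continuous.tendsto 1).comp hη))
    simpa [H.apply_one] using this
  have hbound : ∀ᶠ x in atTop, a x * p x + b x * q x ≤ 2 + (c + 1) := by
    filter_upwards [hη.eventually_lt_const (show (1 : ℝ) < 2 by norm_num),
      hsp.eventually_lt_const (show c < c + 1 by linarith)] with x h1 h2
    rw [← hcx] at h2
    nlinarith [sq_nonneg (a x - p x), sq_nonneg (b x - q x), sq_nonneg (a x), sq_nonneg (b x),
      sq_nonneg (p x), sq_nonneg (q x)]
  have hc1 : c ≤ 0 := nonpos_of_hasDerivAt_of_bounded hSd hSlim hbound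
  rw [hcx, le_antisymm hc1 hc0, zero_add]

/-- The angular momentum of an orbit tending to the unit circle vanishes. -/
theorem angularMomentum_eq_zero (h : IsPlanarOrbit f a b p q) (H : Coercive f lam) (x : ℝ) :
    a x * q x - b x * p x = 0 := by
  have hd : ∀ x, HasDerivAt (fun x => a x * q x - b x * p x) 0 x := by
    intro x
    have h1 := ((h.hasDerivAt_a x).mul (h.hasDerivAt_q x)).sub
      ((h.hasDerivAt_b x).mul (h.hasDerivAt_p x))
    convert! h1 using 1
    ring
  have hconst : ∀ x y, a x * q x - b x * p x = a y * q y - b y * p y :=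
    is_const_of_deriv_eq_zero (fun x => (hd x).differentiableAt) fun x => (hd x).deriv
  have hη : Tendsto (fun x => a x ^ 2 + b x ^ 2) atTop (𝓝 1) :=
    h.tendsto.mono_left (by rw [cocompact_eq_atBot_atTop]; exact le_sup_right)
  have hlim : Tendsto (fun y => (a y ^ 2 + b y ^ 2) * potential f (a y ^ 2 + b y ^ 2)) atTop
      (𝓝 0) := by
    have := hη.mul (((continuous_potential H.continuous).tendsto 1).comp hη)
    simpa [potential_one] using this
  -- Cauchy–Schwarz bounds the conserved square by |v|²|v'|², which tends to `potential f 1 = 0`.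
  have hle : (a x * q x - b x * p x) ^ 2 ≤ 0 :=
    ge_of_tendsto hlim (Eventually.of_forall fun y => by
      rw [← h.speed_sq_eq H, hconst x y]
      nlinarith [sq_nonneg (a y * p y + b y * q y)])
  exact pow_eq_zero_iff two_ne_zero |>.1 (le_antisymm hle (sq_nonneg _))

/-- A nonconstant orbit passes through the origin. -/
theorem exists_eq_zero (h : IsPlanarOrbit f a b p q) (H : Coercive f lam)
    (hne : ∃ x, p x ≠ 0 ∨ q x ≠ 0) : ∃ x, a x = 0 ∧ b x = 0 := by
  have hx₀ : ∃ x, a x ^ 2 + b x ^ 2 ≠ 1 := by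
    by_contra hcon
    push Not at hcon
    obtain ⟨x, hx⟩ := hne
    have h1 := h.speed_sq_eq H x
    rw [hcon, potential_one] at h1
    have h2 : p x = 0 := by nlinarith [sq_nonneg (p x), sq_nonneg (q x)]
    have h3 : q x = 0 := by nlinarith [sq_nonneg (p x), sq_nonneg (q x)]
    exact hx.elim (· h2) (· h3)
  obtain ⟨x₀, hx₀⟩ := hx₀
  -- At a critical point of the squared modulus the radial product vanishes. With zero angular
  -- momentum, Lagrange's identity gives |v|²|v'|² = 0, while |v'|² is nonzero because |v| ≠ 1.
  obtain ⟨x, hx, hx1⟩ := exists_deriv_eq_zero_of_tendsto_cocompact h.hasDerivAt_normSq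
    h.tendsto hx₀
  have h1 := h.speed_sq_eq H x
  have h2 := h.angularMomentum_eq_zero H x
  have h3 : a x * p x + b x * q x = 0 := by linarith
  have h4 : (a x ^ 2 + b x ^ 2) * potential f (a x ^ 2 + b x ^ 2) = 0 := by
    rw [← h1]
    linear_combination (a x * p x + b x * q x) * h3 + (a x * q x - b x * p x) * h2
  have h5 : potential f (a x ^ 2 + b x ^ 2) ≠ 0 := by
    refine (lt_of_lt_of_le ?_ (H.le_potential _ (by positivity))).ne'
    exact mul_pos H.pos (sq_pos_of_ne_zero (sub_ne_zero.2 hx1.symm))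
  have h6 := (mul_eq_zero.1 h4).resolve_right h5
  exact ⟨x, by nlinarith [sq_nonneg (a x), sq_nonneg (b x)],
    by nlinarith [sq_nonneg (a x), sq_nonneg (b x)]⟩

end IsPlanarOrbit

/-- Every kink is a translated and rotated copy of the real profile. -/
theorem IsProfile.exists_eq_rotate {w : ℝ → ℝ} (hw : IsProfile f w) (H : Coercive f lam)
    {v : ℝ → ℂ} (hv : IsKink f v) :
    ∃ (α : ℂ) (x₀ : ℝ), ‖α‖ = 1 ∧ v = fun x => α * (w (x - x₀) : ℂ) := by
  obtain ⟨hv2, heq⟩ := hv.travellingWave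
  have hd0 : ∀ x, HasDerivAt v (deriv v x) x := fun x =>
    (hv2.differentiable (by norm_num) x).hasDerivAt
  have hd1 : ∀ x, HasDerivAt (deriv v) (-(v x * (f (‖v x‖ ^ 2) : ℂ))) x := fun x => by
    have h1 : ContDiff ℝ 1 (deriv v) := by
      rw [show (2 : WithTop ℕ∞) = 1 + 1 by norm_num, contDiff_succ_iff_deriv] at hv2
      exact hv2.2.2
    have h2 := (h1.differentiable (by norm_num) x).hasDerivAt
    have h3 := heq x
    have h4 : deriv (deriv v) x = -(v x * (f (‖v x‖ ^ 2) : ℂ)) := by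
      simp only [Complex.ofReal_zero, mul_zero, zero_mul, zero_add] at h3
      exact eq_neg_of_add_eq_zero_left h3
    rwa [h4] at h2
  have horb : IsPlanarOrbit f (fun x => (v x).re) (fun x => (v x).im) (fun x => (deriv v x).re)
      (fun x => (deriv v x).im) := by
    refine ⟨fun x => Complex.reCLM.hasFDerivAt.comp_hasDerivAt x (hd0 x),
      fun x => Complex.imCLM.hasFDerivAt.comp_hasDerivAt x (hd0 x), fun x => ?_, fun x => ?_, ?_⟩
    · convert! Complex.reCLM.hasFDerivAt.comp_hasDerivAt x (hd1 x) using 1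
      simp [norm_sq_eq]
    · convert! Complex.imCLM.hasFDerivAt.comp_hasDerivAt x (hd1 x) using 1
      simp [norm_sq_eq]
    · simp_rw [← norm_sq_eq, cocompact_eq_atBot_atTop]
      refine Tendsto.sup ?_ ?_
      · simpa using hv.tendsto_atBot.pow 2
      · simpa using hv.tendsto_atTop.pow 2
  have hne : ∃ x, (deriv v x).re ≠ 0 ∨ (deriv v x).im ≠ 0 := by
    by_contra hcon
    push Not at hcon
    refine hv.nonconstant ⟨v 0, fun x => ?_⟩
    exact is_const_of_deriv_eq_zero (hv2.differentiable (by norm_num))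
      (fun x => Complex.ext (hcon x).1 (hcon x).2) x 0
  obtain ⟨x₀, hre, him⟩ := horb.exists_eq_zero H hne
  have hv0 : v x₀ = 0 := Complex.ext hre him
  have hs0 : 0 < speed f 0 := H.speed_pos (by norm_num)
  have hs0' : (speed f 0 : ℂ) ≠ 0 := by exact_mod_cast hs0.ne'
  have hn : ‖deriv v x₀‖ ^ 2 = speed f 0 ^ 2 := by
    have h1 := horb.speed_sq_eq H x₀
    rw [← norm_sq_eq, ← norm_sq_eq, hv0, norm_zero] at h1
    rw [h1, H.speed_sq]
  have hn' : ‖deriv v x₀‖ = speed f 0 := (sq_eq_sq₀ (norm_nonneg _) hs0.le).1 hn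
  -- This rotation gives the translated profile the same Cauchy data at `x₀` as `v`.
  set α : ℂ := deriv v x₀ / (speed f 0 : ℂ) with hα
  have hα1 : ‖α‖ = 1 := by
    rw [hα, norm_div, hn', Complex.norm_real, Real.norm_of_nonneg hs0.le, div_self hs0.ne']
  refine ⟨α, x₀, hα1, ?_⟩
  set V : ℂ × ℂ → ℂ × ℂ := fun y => (y.2, -(y.1 * (f (‖y.1‖ ^ 2) : ℂ))) with hVdef
  have hV : ContDiff ℝ 1 V := by
    have h1 : ContDiff ℝ 1 fun y : ℂ × ℂ => f (‖y.1‖ ^ 2) :=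
      (H.contDiff.of_le (by norm_num)).comp ((contDiff_norm_sq ℝ).comp contDiff_fst)
    exact contDiff_snd.prodMk
      (contDiff_fst.mul (Complex.ofRealCLM.contDiff.comp h1)).neg
  have hsol := eq_of_hasDerivAt_of_contDiff hV (y := fun x => (v x, deriv v x))
    (z := fun x => (α * (w (x - x₀) : ℂ), α * (speed f (w (x - x₀)) : ℂ)))
    (fun x => (hd0 x).prodMk (hd1 x))
    (fun x => by
      have := (hw.hasDerivAt_rotate α x₀ x).prodMk (hw.hasDerivAt_rotate_speed H α x₀ x)
      convert! this using 1
      simp only [hVdef]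
      congr 1
      rw [norm_mul, hα1, one_mul, Complex.norm_real, Real.norm_eq_abs, sq_abs]
      push_cast
      ring)
    (t₀ := x₀) (by simp [hv0, hw.zero, hα, hs0'])
  exact funext fun x => congrArg Prod.fst (congrFun hsol x)

theorem IsKink.mem_energySpace_and_energy_eq (H : Coercive f lam) {v : ℝ → ℂ} (hv : IsKink f v) :
    v ∈ energySpace f ∧ energy f v = kinkEnergy f := by
  obtain ⟨w, hw⟩ := H.exists_isProfile
  obtain ⟨α, x₀, hα, rfl⟩ := hw.exists_eq_rotate H hv
  exact hw.rotate_mem_energySpace H hα x₀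

end Uniqueness

/-! ### Competitors near and below the kink energy -/

section MinimalEnergy

variable {f : ℝ → ℝ} {lam : ℝ}

namespace Coercive

theorem kinkEnergy_pos (H : Coercive f lam) : 0 < kinkEnergy f := by
  refine mul_pos two_pos (intervalIntegral.intervalIntegral_pos_of_pos_on
    ((continuous_speed H.continuous).intervalIntegrable _ _) (fun s hs => H.speed_pos ?_)
    one_pos)
  nlinarith [hs.1, hs.2]

/-- `f` is bounded on `[0, 1]`. Since its sign there is not prescribed, the potential may increase,
and raising the modulus has to be paid for. -/
theorem exists_potential_perturb_le (H : Coercive f lam) :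
    ∃ M, 0 ≤ M ∧ ∀ t ∈ Icc (0 : ℝ) 1, ∀ s ∈ Icc t 1,
      potential f s ≤ potential f t + M * (s - t) := by
  obtain ⟨M, hM⟩ := (isCompact_Icc (a := (0 : ℝ)) (b := 1)).exists_bound_of_continuousOn
    H.continuous.continuousOn
  refine ⟨M, (norm_nonneg _).trans (hM 0 (by simp)), fun t ht s hs => ?_⟩
  have := (convex_Icc (0 : ℝ) 1).norm_image_sub_le_of_norm_hasDerivWithin_le
    (fun r _ => (hasDerivAt_potential H.continuous r).hasDerivWithinAt)
    (fun r hr => by rw [norm_neg]; exact hM r hr) ht ⟨ht.1.trans hs.1, hs.2⟩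
  rw [Real.norm_eq_abs, Real.norm_of_nonneg (sub_nonneg.2 hs.1)] at this
  linarith [le_abs_self (potential f s - potential f t)]

theorem one_sub_sq_le (H : Coercive f lam) (s : ℝ) :
    (1 - s ^ 2) ^ 2 ≤ lam⁻¹ * speed f s ^ 2 := by
  rw [H.speed_sq, le_inv_mul_iff₀ H.pos]
  exact H.le_potential _ (sq_nonneg s)

end Coercive

/-- Bounds on the squared modulus of the regularised kink. -/
theorem regularized_bounds {t ε : ℝ} (ht0 : 0 ≤ t) (ht1 : t ≤ 1) (hε : 0 < ε) (hε1 : ε ≤ 1 / 2) :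
    (ε / 2) ^ 2 ≤ t + ε ^ 2 * (1 - t) ^ 2 ∧ t + ε ^ 2 * (1 - t) ^ 2 ≤ 1 ∧
      t ≤ t + ε ^ 2 * (1 - t) ^ 2 := by
  have h1 : ε ^ 2 ≤ 1 / 4 := by nlinarith
  have h2 : 0 < ε ^ 2 := by positivity
  have h3 : 0 ≤ ε ^ 2 * (1 - t) ^ 2 := by positivity
  refine ⟨?_, ?_, by linarith⟩
  · nlinarith [mul_le_mul_of_nonneg_right h1 ht0, mul_nonneg h2.le (sq_nonneg (1 / 2 - t))]
  · nlinarith [mul_le_mul_of_nonneg_right h1 (sq_nonneg (1 - t)), mul_nonneg ht0 (sub_nonneg.2 ht1)]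

namespace IsProfile

variable {w : ℝ → ℝ}

/-- Regularising the kink and twisting its phase near the zero realises every momentum at almost
the energy of the kink. -/
theorem exists_energy_le (hw : IsProfile f w) (H : Coercive f lam) (q : ℝ) :
    ∃ A ε₀ : ℝ, 0 < ε₀ ∧ ∀ ε, 0 < ε → ε ≤ ε₀ →
      ∃ u ∈ nonvanishingEnergySpace f, momentum u = q ∧ energy f u ≤ kinkEnergy f + A * ε := by
  obtain ⟨M, hM0, hM⟩ := H.exists_potential_perturb_le
  obtain ⟨B, hB0, hB⟩ := H.exists_speed_le_mul
  have hl := H.pos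
  have hsB : ∀ x, speed f (w x) ≤ B := fun x => by
    have := hB _ (hw.mem x)
    nlinarith [sq_nonneg (w x)]
  have hwB : ∀ x, |w x| ≤ B * |x| := fun x => by
    have := convex_univ.norm_image_sub_le_of_norm_hasDerivWithin_le (s := univ) (x := 0) (y := x)
      (fun y _ => (hw.hasDerivAt y).hasDerivWithinAt)
      (fun y _ => by rw [Real.norm_of_nonneg (speed_nonneg _ _)]; exact hsB y)
      (mem_univ _) (mem_univ _)
    simpa [hw.zero] using this
  have hk := H.kinkEnergy_pos
  -- The two terms pay for lifting the zero and for the twist. The bound on `ε` keeps |w| at most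
  -- 1/2 on `[-ε, ε]`.
  refine ⟨M * lam⁻¹ / 2 * kinkEnergy f + 4 * (B ^ 2 + 1) * q ^ 2, min (1 / 2) (1 / (2 * B)),
    lt_min (by norm_num) (by positivity), fun ε hε hεle => ?_⟩
  have hε1 : ε ≤ 1 / 2 := hεle.trans (min_le_left _ _)
  have hεB : B * ε ≤ 1 / 2 := by
    have := mul_le_mul_of_nonneg_left (hεle.trans (min_le_right _ _)) hB0.le
    have e : B * (1 / (2 * B)) = 1 / 2 := by field_simp
    linarith
  have hwc := hw.continuous
  have hhc : Continuous fun x => speed f (w x) := (continuous_speed H.continuous).comp hwc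
  -- This is |w + iε(1 - w²)|²: the zero is lifted to height `ε`, and the added term is integrable
  -- by coercivity.
  set P : ℝ → ℝ := fun x => w x ^ 2 + ε ^ 2 * (1 - w x ^ 2) ^ 2 with hP
  have hPb : ∀ x, (ε / 2) ^ 2 ≤ P x ∧ P x ≤ 1 ∧ w x ^ 2 ≤ P x := fun x =>
    regularized_bounds (sq_nonneg _) (hw.sq_lt_one x).le hε hε1
  have hP0 : ∀ x, 0 < P x := fun x => lt_of_lt_of_le (by positivity) (hPb x).1
  have hPc : Continuous P :=
    (hwc.pow 2).add (continuous_const.mul ((continuous_const.sub (hwc.pow 2)).pow 2))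
  set ρ : ℝ → ℝ := fun x => √(P x) with hρdef
  have hρsq : ∀ x, ρ x ^ 2 = P x := fun x => Real.sq_sqrt (hP0 x).le
  have hρ0 : ∀ x, 0 < ρ x := fun x => Real.sqrt_pos.2 (hP0 x)
  have hρc : Continuous ρ := Real.continuous_sqrt.comp hPc
  set ρ' : ℝ → ℝ := fun x => w x * speed f (w x) * (1 - 2 * ε ^ 2 * (1 - w x ^ 2)) / ρ x with hρ'
  have hd : ∀ x, HasDerivAt ρ (ρ' x) x := fun x => by
    have h1 := (hw.hasDerivAt x).pow 2
    have h2 := (h1.add (((h1.const_sub 1).pow 2).const_mul (ε ^ 2))).sqrt (hP0 x).ne'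
    convert! h2 using 1
    simp only [hρ', hρdef, hP]
    have : √(w x ^ 2 + ε ^ 2 * (1 - w x ^ 2) ^ 2) ≠ 0 := (hρ0 x).ne'
    simp only [Pi.add_apply, Pi.pow_apply]
    field_simp
    norm_num
    ring
  have hρ'c : Continuous ρ' := ((hwc.mul hhc).mul (continuous_const.sub (continuous_const.mul
    (continuous_const.sub (hwc.pow 2))))).div hρc fun x => (hρ0 x).ne'
  have hρ'le : ∀ x, ρ' x ^ 2 ≤ speed f (w x) ^ 2 := fun x => by
    have h1 := (hw.sq_lt_one x).le
    have h2 : ε ^ 2 ≤ 1 / 4 := by nlinarith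
    have h3 : 0 ≤ ε ^ 2 * (1 - w x ^ 2) := by have := sub_nonneg.2 h1; positivity
    have h4 : ε ^ 2 * (1 - w x ^ 2) ≤ 1 / 4 := by nlinarith [sq_nonneg (w x), sq_nonneg ε]
    have h5 : (1 - 2 * ε ^ 2 * (1 - w x ^ 2)) ^ 2 ≤ 1 := by nlinarith
    rw [hρ', div_pow, mul_pow, mul_pow, hρsq, div_le_iff₀ (hP0 x)]
    calc w x ^ 2 * speed f (w x) ^ 2 * (1 - 2 * ε ^ 2 * (1 - w x ^ 2)) ^ 2
        ≤ w x ^ 2 * speed f (w x) ^ 2 * 1 := by gcongr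
      _ = speed f (w x) ^ 2 * w x ^ 2 := by ring
      _ ≤ speed f (w x) ^ 2 * P x := by gcongr; exact (hPb x).2.2
  have hi := hw.integrable_speed_sq H
  have hρ'i : Integrable fun x => ρ' x ^ 2 := hi.mono' (hρ'c.pow 2).aestronglyMeasurable
    (Eventually.of_forall fun x => by rw [Real.norm_of_nonneg (sq_nonneg _)]; exact hρ'le x)
  have hFle : ∀ x, potential f (ρ x ^ 2) ≤ (1 + M * lam⁻¹ * ε ^ 2) * speed f (w x) ^ 2 := fun x => by
    have h1 := hM (w x ^ 2) ⟨sq_nonneg _, (hw.sq_lt_one x).le⟩ (P x) ⟨(hPb x).2.2, (hPb x).2.1⟩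
    have h2 : P x - w x ^ 2 = ε ^ 2 * (1 - w x ^ 2) ^ 2 := by simp only [hP]; ring
    have h3 : M * (ε ^ 2 * (1 - w x ^ 2) ^ 2) ≤ M * (ε ^ 2 * (lam⁻¹ * speed f (w x) ^ 2)) := by
      gcongr
      exact H.one_sub_sq_le (w x)
    rw [h2, ← H.speed_sq] at h1
    rw [hρsq]
    linarith
  have hFi : Integrable fun x => potential f (ρ x ^ 2) := (hi.const_mul _).mono'
    ((continuous_potential H.continuous).comp (hρc.pow 2)).aestronglyMeasurable
    (Eventually.of_forall fun x => by
      rw [Real.norm_of_nonneg (H.potential_sq_nonneg _)]; exact hFle x)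
  obtain ⟨hIi, htw⟩ := H.exists_twisted_profile (c := ε / 2) (by positivity)
    (fun x => Real.le_sqrt_of_sq_le (hPb x).1) hd hρ'c hρ'i hFi
  set I := ∫ x, ((1 - ρ x ^ 2) / ρ x) ^ 2 with hI
  -- Only `[-ε, ε]` is used: there `P` is O(ε²) and at most 1/2, so the integrand is at least of
  -- order ε⁻² on length `2 * ε`.
  have hIlow : 1 / (2 * (B ^ 2 + 1) * ε) ≤ I := by
    have h1 : ∫ _ in Icc (-ε) ε, (1 / (4 * (B ^ 2 + 1) * ε ^ 2) : ℝ) ≤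
        ∫ x in Icc (-ε) ε, ((1 - ρ x ^ 2) / ρ x) ^ 2 := by
      refine setIntegral_mono_on (integrableOn_const (by simp)) hIi.integrableOn measurableSet_Icc
        fun x hx => ?_
      have hx' : |x| ≤ ε := abs_le.2 hx
      have hw1 : |w x| ≤ B * ε := (hwB x).trans (mul_le_mul_of_nonneg_left hx' hB0.le)
      have hw2 : w x ^ 2 ≤ (B * ε) ^ 2 := by
        rw [← sq_abs (w x)]; exact pow_le_pow_left₀ (abs_nonneg _) hw1 2
      have hw3 : w x ^ 2 ≤ 1 / 4 := by
        have := pow_le_pow_left₀ (by positivity) hεB 2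
        linarith
      have h2 : ε ^ 2 ≤ 1 / 4 := by nlinarith
      have h5 : (1 - w x ^ 2) ^ 2 ≤ 1 := by nlinarith [sq_nonneg (w x)]
      have h6 : P x ≤ (B ^ 2 + 1) * ε ^ 2 := by
        simp only [hP]
        nlinarith [mul_le_mul_of_nonneg_left h5 (sq_nonneg ε)]
      have h7 : P x ≤ 1 / 2 := by
        simp only [hP]
        nlinarith [mul_le_mul_of_nonneg_left h5 (sq_nonneg ε)]
      have h8 : (1 / 2 : ℝ) ^ 2 ≤ (1 - P x) ^ 2 := pow_le_pow_left₀ (by norm_num) (by linarith) 2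
      rw [div_pow, hρsq, div_le_div_iff₀ (by positivity) (hP0 x)]
      nlinarith [mul_le_mul_of_nonneg_right h8 (show 0 ≤ (B ^ 2 + 1) * ε ^ 2 by positivity)]
    rw [setIntegral_const] at h1
    have h2 : volume.real (Icc (-ε) ε) = 2 * ε := by
      rw [measureReal_def, Real.volume_Icc, ENNReal.toReal_ofReal (by linarith)]; ring
    rw [h2, smul_eq_mul] at h1
    have h3 : 2 * ε * (1 / (4 * (B ^ 2 + 1) * ε ^ 2)) = 1 / (2 * (B ^ 2 + 1) * ε) := by
      field_simp; ring
    rw [h3] at h1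
    exact h1.trans (setIntegral_le_integral hIi (Eventually.of_forall fun x => sq_nonneg _))
  have hIpos : 0 < I := lt_of_lt_of_le (by positivity) hIlow
  -- The twist amplitude solves `a / 2 * I = q` and costs `2 * q ^ 2 / I`.
  obtain ⟨u, hu, hp, hE⟩ := htw (2 * q / I)
  refine ⟨u, hu, by rw [hp]; field_simp, ?_⟩
  have e1 : ∫ x, ρ' x ^ 2 ≤ kinkEnergy f := by
    rw [← hw.integral_speed_sq H]
    exact integral_mono hρ'i hi hρ'le
  have e2 : ∫ x, potential f (ρ x ^ 2) ≤ (1 + M * lam⁻¹ * ε ^ 2) * kinkEnergy f := by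
    rw [← hw.integral_speed_sq H, ← integral_const_mul]
    exact integral_mono hFi (hi.const_mul _) hFle
  have e3 : (2 * q / I) ^ 2 / 2 * I = 2 * q ^ 2 * (1 / I) := by field_simp
  have e4 : 1 / I ≤ 2 * (B ^ 2 + 1) * ε := by
    rw [div_le_iff₀ hIpos]
    rw [div_le_iff₀ (by positivity)] at hIlow
    linarith
  have e5 : 2 * q ^ 2 * (1 / I) ≤ 2 * q ^ 2 * (2 * (B ^ 2 + 1) * ε) := by gcongr
  have e6 : M * lam⁻¹ / 2 * kinkEnergy f * ε ^ 2 ≤ M * lam⁻¹ / 2 * kinkEnergy f * ε := by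
    gcongr
    nlinarith
  rw [hE, e3]
  linarith

/-- Shallow dark profiles have small energy and positive momentum. -/
theorem exists_energy_lt (hw : IsProfile f w) (H : Coercive f lam) :
    ∃ u ∈ nonvanishingEnergySpace f, 0 < momentum u ∧ energy f u < kinkEnergy f := by
  obtain ⟨L, hL0, hL⟩ := H.exists_potential_le
  have hl := H.pos
  have hk := H.kinkEnergy_pos
  -- The untwisted dip costs at most `A * ε ^ 2 * kinkEnergy f`; the choice of `ε` makes this a
  -- quarter of the kink energy, and the twist chosen later adds at most half.
  set A : ℝ := 2 + 2 * (L * lam⁻¹) with hA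
  have hA0 : 0 < A := by positivity
  set ε : ℝ := min (1 / 2) (1 / (2 * A)) with hεdef
  have hε : 0 < ε := lt_min (by norm_num) (by positivity)
  have hε1 : ε ≤ 1 / 2 := min_le_left _ _
  have hεA : A * ε ^ 2 ≤ 1 / 4 := by
    have h1 : A * ε ≤ 1 / 2 := by
      have := mul_le_mul_of_nonneg_left (min_le_right (1 / 2) (1 / (2 * A))) hA0.le
      have e : A * (1 / (2 * A)) = 1 / 2 := by field_simp
      linarith
    nlinarith
  have hwc := hw.continuous
  have hhc : Continuous fun x => speed f (w x) := (continuous_speed H.continuous).comp hwc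
  have hi := hw.integrable_speed_sq H
  set ρ : ℝ → ℝ := fun x => 1 - ε * (1 - w x ^ 2) with hρdef
  have hρc : Continuous ρ :=
    continuous_const.sub (continuous_const.mul (continuous_const.sub (hwc.pow 2)))
  have hρ1 : ∀ x, 1 / 2 ≤ ρ x := fun x => by
    simp only [hρdef]; nlinarith [sq_nonneg (w x)]
  have hρ2 : ∀ x, ρ x < 1 := fun x => by
    have := mul_pos hε (sub_pos.2 (hw.sq_lt_one x))
    simp only [hρdef]; linarith
  set ρ' : ℝ → ℝ := fun x => 2 * ε * (w x * speed f (w x)) with hρ'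
  have hd : ∀ x, HasDerivAt ρ (ρ' x) x := fun x => by
    have h1 := (((hw.hasDerivAt x).pow 2).const_sub 1).const_mul ε |>.const_sub 1
    convert! h1 using 1
    simp only [hρ']
    norm_num
    ring
  have hρ'c : Continuous ρ' := continuous_const.mul (hwc.mul hhc)
  have hρ'le : ∀ x, ρ' x ^ 2 ≤ 4 * ε ^ 2 * speed f (w x) ^ 2 := fun x => by
    have e : ρ' x ^ 2 = 4 * ε ^ 2 * speed f (w x) ^ 2 * w x ^ 2 := by simp only [hρ']; ring
    rw [e]
    exact mul_le_of_le_one_right (by positivity) (hw.sq_lt_one x).le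
  have hρ'i : Integrable fun x => ρ' x ^ 2 := (hi.const_mul _).mono'
    (hρ'c.pow 2).aestronglyMeasurable
    (Eventually.of_forall fun x => by rw [Real.norm_of_nonneg (sq_nonneg _)]; exact hρ'le x)
  have hFle : ∀ x, potential f (ρ x ^ 2) ≤ 4 * L * lam⁻¹ * ε ^ 2 * speed f (w x) ^ 2 := fun x => by
    have h0 : ρ x ^ 2 ≤ 1 := by nlinarith [hρ1 x, hρ2 x]
    have h1 := hL (ρ x ^ 2) ⟨sq_nonneg _, h0⟩
    have h2 : (1 - ρ x ^ 2) ^ 2 ≤ 4 * (ε ^ 2 * (1 - w x ^ 2) ^ 2) := by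
      have e : (1 - ρ x ^ 2) ^ 2 = (1 + ρ x) ^ 2 * (ε ^ 2 * (1 - w x ^ 2) ^ 2) := by
        simp only [hρdef]; ring
      rw [e]
      have : (1 + ρ x) ^ 2 ≤ 4 := by nlinarith [hρ1 x, hρ2 x]
      gcongr
    have h3 := H.one_sub_sq_le (w x)
    calc potential f (ρ x ^ 2) ≤ L * (1 - ρ x ^ 2) ^ 2 := h1
      _ ≤ L * (4 * (ε ^ 2 * (lam⁻¹ * speed f (w x) ^ 2))) := by
        refine mul_le_mul_of_nonneg_left (h2.trans ?_) hL0.le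
        gcongr
      _ = _ := by ring
  have hFi : Integrable fun x => potential f (ρ x ^ 2) := (hi.const_mul _).mono'
    ((continuous_potential H.continuous).comp (hρc.pow 2)).aestronglyMeasurable
    (Eventually.of_forall fun x => by
      rw [Real.norm_of_nonneg (H.potential_sq_nonneg _)]; exact hFle x)
  obtain ⟨hIi, htw⟩ := H.exists_twisted_profile (c := 1 / 2) (by norm_num) hρ1 hd hρ'c hρ'i hFi
  set I := ∫ x, ((1 - ρ x ^ 2) / ρ x) ^ 2 with hI
  have hIpos : 0 < I := by
    rw [hI, integral_pos_iff_support_of_nonneg (fun _ => sq_nonneg _) hIi]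
    have : (Function.support fun x => ((1 - ρ x ^ 2) / ρ x) ^ 2) = univ := by
      refine eq_univ_of_forall fun x => ?_
      have h1 := hρ1 x
      have h2 := hρ2 x
      have h3 : 0 < 1 - ρ x ^ 2 := by nlinarith
      exact (pow_pos (div_pos h3 (by linarith)) 2).ne'
    simp [this]
  have e1 : ∫ x, ρ' x ^ 2 ≤ 4 * ε ^ 2 * kinkEnergy f := by
    rw [← hw.integral_speed_sq H, ← integral_const_mul]
    exact integral_mono hρ'i (hi.const_mul _) hρ'le
  have e2 : ∫ x, potential f (ρ x ^ 2) ≤ 4 * L * lam⁻¹ * ε ^ 2 * kinkEnergy f := by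
    rw [← hw.integral_speed_sq H, ← integral_const_mul]
    exact integral_mono hFi (hi.const_mul _) hFle
  set a : ℝ := min 1 (kinkEnergy f / I) with ha
  have ha0 : 0 < a := lt_min one_pos (by positivity)
  obtain ⟨u, hu, hp, hE⟩ := htw a
  refine ⟨u, hu, by rw [hp]; positivity, ?_⟩
  have e3 : a ^ 2 / 2 * I ≤ kinkEnergy f / 2 := by
    have h1 : a * I ≤ kinkEnergy f := by
      rw [← le_div_iff₀ hIpos]; exact min_le_right _ _
    have h2 : a ≤ 1 := min_le_left _ _
    nlinarith
  have e4 : A * ε ^ 2 * kinkEnergy f ≤ 1 / 4 * kinkEnergy f := by gcongr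
  rw [hE]
  have e5 : A * ε ^ 2 * kinkEnergy f = 1 / 2 * (4 * ε ^ 2 * kinkEnergy f) +
      1 / 2 * (4 * L * lam⁻¹ * ε ^ 2 * kinkEnergy f) := by rw [hA]; ring
  linarith

end IsProfile

/-! ### The sublevel set and the critical momentum -/

namespace Coercive

theorem Emin_le (H : Coercive f lam) {v : ℝ → ℂ} (hv : v ∈ nonvanishingEnergySpace f) :
    Emin f (momentum v) ≤ energy f v :=
  csInf_le ⟨0, by rintro _ ⟨u, -, -, rfl⟩; exact H.energy_nonneg u⟩ ⟨v, hv, rfl, rfl⟩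

/-- Without competitors `sInf ∅ = 0` would make `Emin` meaningless; with them, an upper bound on
`Emin` produces a function. -/
theorem exists_momentum_eq (H : Coercive f lam) (q : ℝ) :
    ∃ u ∈ nonvanishingEnergySpace f, momentum u = q := by
  obtain ⟨w, hw⟩ := H.exists_isProfile
  obtain ⟨A, ε₀, h0, h⟩ := hw.exists_energy_le H q
  obtain ⟨u, hu, hp, -⟩ := h ε₀ h0 le_rfl
  exact ⟨u, hu, hp⟩

theorem Emin_le_kinkEnergy (H : Coercive f lam) (q : ℝ) : Emin f q ≤ kinkEnergy f := by
  obtain ⟨w, hw⟩ := H.exists_isProfile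
  obtain ⟨A, ε₀, h0, h⟩ := hw.exists_energy_le H q
  have hlim : Tendsto (fun ε => kinkEnergy f + A * ε) (𝓝[>] 0) (𝓝 (kinkEnergy f)) := by
    have : Continuous fun ε => kinkEnergy f + A * ε := by fun_prop
    simpa using (this.tendsto 0).mono_left nhdsWithin_le_nhds
  refine ge_of_tendsto hlim ?_
  filter_upwards [Ioc_mem_nhdsGT h0] with ε hε
  obtain ⟨u, hu, rfl, hE⟩ := h ε hε.1 hε.2
  exact (H.Emin_le hu).trans hE

/-- The kink vanishes somewhere, so it violates the defining condition as soon as its energy is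
admissible; conversely nothing cheaper than the kink comes arbitrarily close to zero. -/
theorem mem_nonvanishingMomenta_iff (H : Coercive f lam) {q : ℝ} :
    q ∈ nonvanishingMomenta f ↔ 0 < q ∧ Emin f q < kinkEnergy f := by
  refine ⟨fun hq => ⟨hq.1, ?_⟩, fun hq => ⟨hq.1, fun v hv hE => ?_⟩⟩
  · by_contra hlt
    obtain ⟨w, hw⟩ := H.exists_isProfile
    obtain ⟨hmem, hE⟩ := (hw.isKink H).mem_energySpace_and_energy_eq H
    refine (hq.2 _ hmem (hE.trans_le (not_lt.1 hlt))).not_ge ?_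
    simpa [hw.zero] using ciInf_le (bddBelow_range_norm fun x => (w x : ℂ)) 0
  · by_contra h0
    exact ((H.kinkEnergy_le_energy hv h0).trans hE).not_gt hq.2

theorem nonempty_nonvanishingMomenta (H : Coercive f lam) : (nonvanishingMomenta f).Nonempty := by
  obtain ⟨w, hw⟩ := H.exists_isProfile
  obtain ⟨u, hu, hp, hE⟩ := hw.exists_energy_lt H
  exact ⟨momentum u, H.mem_nonvanishingMomenta_iff.2 ⟨hp, (H.Emin_le hu).trans_lt hE⟩⟩

theorem exists_energy_lt_of_Emin_lt (H : Coercive f lam) {q e : ℝ} (h : Emin f q < e) :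
    ∃ v ∈ nonvanishingEnergySpace f, momentum v = q ∧ energy f v < e := by
  obtain ⟨u, hu, hp⟩ := H.exists_momentum_eq q
  obtain ⟨_, ⟨v, hv, hq, rfl⟩, hlt⟩ := exists_lt_of_csInf_lt
    (s := {e | ∃ v ∈ nonvanishingEnergySpace f, momentum v = q ∧ energy f v = e})
    ⟨_, u, hu, hp, rfl⟩ h
  exact ⟨v, hv, hq, hlt⟩

theorem bddAbove_nonvanishingMomenta (H : Coercive f lam) : BddAbove (nonvanishingMomenta f) := by
  obtain ⟨Q, hQ⟩ := H.exists_abs_momentum_le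
  refine ⟨Q, fun q hq => ?_⟩
  obtain ⟨v, hv, rfl, hE⟩ := H.exists_energy_lt_of_Emin_lt (H.mem_nonvanishingMomenta_iff.1 hq).2
  exact (le_abs_self _).trans (hQ v hv hE)

theorem qStar_pos (H : Coercive f lam) : 0 < qStar f := by
  obtain ⟨q, hq⟩ := H.nonempty_nonvanishingMomenta
  exact hq.1.trans_le (le_csSup H.bddAbove_nonvanishingMomenta hq)

/-- The set of momenta with energy below that of the kink is open to the right. -/
theorem exists_gt_mem_nonvanishingMomenta (H : Coercive f lam) {q : ℝ}
    (hq : q ∈ nonvanishingMomenta f) : ∃ q' ∈ nonvanishingMomenta f, q < q' := by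
  obtain ⟨h0, hlt⟩ := H.mem_nonvanishingMomenta_iff.1 hq
  obtain ⟨v, hv, rfl, hE⟩ := H.exists_energy_lt_of_Emin_lt hlt
  have hI := H.integral_vacuumDefect_pos hv h0.ne'
  set I := ∫ x, vacuumDefect v x ^ 2 with hIdef
  -- As `a` decreases to 0 the energy change vanishes, while the momentum gain `a / 2 * I` stays
  -- strictly positive.
  have hlim : Tendsto (fun a => energy f v + 2 * a * momentum v + a ^ 2 / 2 * I) (𝓝[>] 0)
      (𝓝 (energy f v)) := by
    have : Continuous fun a => energy f v + 2 * a * momentum v + a ^ 2 / 2 * I := by fun_prop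
    simpa using (this.tendsto 0).mono_left nhdsWithin_le_nhds
  obtain ⟨a, ha, ha0⟩ := ((hlim.eventually_lt_const hE).and self_mem_nhdsWithin).exists
  have ha0 : 0 < a := ha0
  obtain ⟨u, hu, hp, hEu⟩ := H.exists_phase_twist hv a
  have hgt : momentum v < momentum u := by
    rw [hp]
    have : 0 < a / 2 * I := by positivity
    linarith
  exact ⟨momentum u, H.mem_nonvanishingMomenta_iff.2
    ⟨h0.trans hgt, (H.Emin_le hu).trans_lt (by rwa [hEu])⟩, hgt⟩

/-- A strict inequality at `q` would put `q` in the set, hence also some larger momentum,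
contradicting the supremum even when `q = qStar f`. -/
theorem Emin_eq_kinkEnergy (H : Coercive f lam) {q : ℝ} (hq : qStar f ≤ q) :
    Emin f q = kinkEnergy f := by
  refine le_antisymm (H.Emin_le_kinkEnergy q) (not_lt.1 fun hlt => ?_)
  obtain ⟨q', hq', hlt'⟩ := H.exists_gt_mem_nonvanishingMomenta
    (H.mem_nonvanishingMomenta_iff.2 ⟨H.qStar_pos.trans_le hq, hlt⟩)
  exact (hq.trans_lt hlt').not_ge (le_csSup H.bddAbove_nonvanishingMomenta hq')

end Coercive

end MinimalEnergy

end NLS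

theorem mainTheorem5 (f : ℝ → ℝ) (hf : ContDiff ℝ 3 f)
    (hF : ∃ lam : ℝ, 0 < lam ∧ ∀ ρ : ℝ, 0 ≤ ρ → lam * (1 - ρ) ^ 2 ≤ NLS.potential f ρ) :
    ((NLS.nonvanishingMomenta f).Nonempty ∧ BddAbove (NLS.nonvanishingMomenta f)) ∧
    (∃ v₀ : ℝ → ℂ, NLS.IsKink f v₀) ∧
    (∀ v₀ : ℝ → ℂ, NLS.IsKink f v₀ → v₀ ∈ NLS.energySpace f ∧
      ∀ q : ℝ, NLS.qStar f ≤ q → NLS.Emin f q = NLS.energy f v₀) ∧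
    (∀ q : ℝ, NLS.qStar f ≤ q → NLS.Emin f q = NLS.Emin f (NLS.qStar f)) := by
  obtain ⟨lam, hlam, hle⟩ := hF
  have H : NLS.Coercive f lam := ⟨hf, hlam, hle⟩
  obtain ⟨w, hw⟩ := H.exists_isProfile
  refine ⟨⟨H.nonempty_nonvanishingMomenta, H.bddAbove_nonvanishingMomenta⟩,
    ⟨_, hw.isKink H⟩, fun v₀ hv => ?_, fun q hq => ?_⟩
  · obtain ⟨hmem, hE⟩ := hv.mem_energySpace_and_energy_eq H
    exact ⟨hmem, fun q hq => (H.Emin_eq_kinkEnergy hq).trans hE.symm⟩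
  · rw [H.Emin_eq_kinkEnergy hq, H.Emin_eq_kinkEnergy le_rfl]
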